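/- Let $\mathcal A=(L_1,\dots,L_{10})$ be an arrangement of $10$ distinct lines in $\mathbb{CP}^2$. The multiplicity of a point is the number of lines of $\mathcal A$ through it, $n_r$ is the number of points of multiplicity $r$, and a multiple point is a point of multiplicity at least $3$. For ordered arrangements of $n$ lines write $L(\mathcal A)=L(\mathcal B)$ if $\dim\bigcap_{i\in S}A_i=\dim\bigcap_{i\in S}B_i$ for every nonempty $S\subseteq\{1,\dots,n\}$, and call $\mathcal A,\mathcal B$ lattice isomorphic if this holds after a permutation of the lines of $\mathcal B$. Let $$\mathcal M_{\mathcal A}=\{\mathcal B\in((\mathbb{CP}^2)^*)^{n}\mid L(\mathcal B)=L(\mathcal A)\}/PGL(3,\mathbb C)$$ with the quotient of the Zariski topology, and let $\mathcal M^c_{\mathcal A}$ be its quotient by complex conjugation. Suppose that every line of $\mathcal A$ passes through at least $3$ multiple points ($\mathcal A$ is non-reductive), that $n_4=2$ and $n_r=0$ for all $r\ge5$, and that the two quadruple points lie on a common line of $\mathcal A$. Then either $\mathcal M^c_{\mathcal A}$ is irreducible, or $\mathcal A$ is lattice isomorphic to one of the arrangements defined by the following equations: 1. $xyz(x-z)(y-z)(x-tz)(y-(1-t)z)(y-x-(1-t)z)(y-x+tz)(y-(2-t)x)=0$,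 where $t=\frac{1\pm\sqrt5}{2}$; 2. $xyz(x-z)(y-z)(x-t_1z)(y-t_2z)(y-x)(y-(t_2-1)x-z)(y-(t_2-1)x-(1-t_1)z)=0$, where $t_1=(t_2-1)^2$ and $(t_2-1)^3-(t_2-1)^2+1=0$; 3. $xyz(x-z)(y-z)(x-t^2z)(y-tz)(y-x)(y+\frac1t x-tz)(y+\frac1t(x-z))=0$, where $t=\frac{-1\pm\sqrt5}{2}$; 4. $xyz(x-z)(y-z)(x-(1+\frac s2)z)(y-(2+s)z)(y-x)(y-sx+sz)(y-sx-z)=0$, where $s=\pm\sqrt2$. In each of the four families, with the lines ordered as the factors are written, the ordered arrangements with the same lattice as a given member are, up to $PGL(3,\mathbb C)$, exactly the members of the family. In families 1, 3 and 4 the moduli space consists of exactly two points, both real (represented by arrangements with real coefficients). In family 2 it consists of exactly three points, of which exactly one is real. In all four families the quotient of the moduli space by complex conjugation consists of exactly two points. -/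

import Mathlib

open scoped LinearAlgebra.Projectivization

noncomputable section

namespace LineArrangement

/-- The coordinate space `ℂ³`. Points of `ℂℙ²` are the elements `[x : y : z]` of `ℙ ℂ V`. A line
`a x + b y + c z = 0` of `ℂℙ²` is recorded by its coefficients `[a : b : c]`, so that
`ℙ ℂ V` also serves as the dual projective plane. -/
abbrev V : Type := Fin 3 → ℂ

/-- An ordered `n`-tuple of lines in `ℂℙ²`, i.e. an element of `((ℂℙ²)^*)ⁿ`. It is an arrangement
of `n` lines when it is injective. -/
abbrev Lines (n : ℕ) : Type := Fin n → ℙ ℂ V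

/-- The linear plane in `ℂ³` lying over the line with coefficients `l`. -/
def plane (l : ℙ ℂ V) : Submodule ℂ V where
  carrier := {v | l.rep ⬝ᵥ v = 0}
  add_mem' := by
    intro a b ha hb
    simp only [Set.mem_ofPred_eq] at *
    rw [dotProduct_add, ha, hb, add_zero]
  zero_mem' := by simp
  smul_mem' := by
    intro c v hv
    simp only [Set.mem_ofPred_eq] at *
    rw [dotProduct_smul, hv, smul_zero]

/-- The point `P` lies on the line `l`. -/
def OnLine (P l : ℙ ℂ V) : Prop := P.submodule ≤ plane l

/-- The multiplicity of the point `P`: the number of lines of the arrangement through `P`. -/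
def mult {n : ℕ} (A : Lines n) (P : ℙ ℂ V) : ℕ∞ := {i | OnLine P (A i)}.encard

/-- `n_r`: the number of points of multiplicity `r`. -/
def numPoints {n : ℕ} (A : Lines n) (r : ℕ) : ℕ∞ := {P | mult A P = r}.encard

/-- Every line of the arrangement passes through at least three multiple points
(points of multiplicity at least `3`). -/
def NonReductive {n : ℕ} (A : Lines n) : Prop :=
  ∀ i, 3 ≤ {P | OnLine P (A i) ∧ 3 ≤ mult A P}.encard

/-- One more than the (projective) dimension of `⋂_{i ∈ S} A i`, the empty set having
dimension `-1`. -/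
def interDim {n : ℕ} (A : Lines n) (S : Finset (Fin n)) : ℕ :=
  Module.finrank ℂ (⨅ i ∈ S, plane (A i) : Submodule ℂ V)

/-- `L(A) = L(B)`: the intersection lattices agree, with the given orderings of the lines. -/
def SameLattice {n : ℕ} (A B : Lines n) : Prop :=
  ∀ S : Finset (Fin n), S.Nonempty → interDim A S = interDim B S

/-- `A ∼ B`: lattice isomorphism, i.e. the lattices agree after a permutation of the lines. -/
def LatticeIso {n : ℕ} (A B : Lines n) : Prop :=
  ∃ φ : Equiv.Perm (Fin n), ∀ S : Finset (Fin n), S.Nonempty →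
    interDim A S = interDim B (S.map φ.toEmbedding)

/-- Projective equivalence of ordered arrangements: being in the same orbit of `PGL(3, ℂ)`.
The group acts on coefficients of lines through invertible linear maps. -/
def projSetoid (n : ℕ) : Setoid (Lines n) := MulAction.orbitRel (V ≃ₗ[ℂ] V) (Lines n)

/-- The Zariski topology on `((ℂℙ²)^*)ⁿ`: a basis of open sets is given by the non-vanishing loci
of polynomials which are homogeneous in each of the `n` triples of coordinates. -/
@[reducible] def zariski (n : ℕ) : TopologicalSpace (Lines n) :=
  TopologicalSpace.generateFrom
    {U | ∃ (F : MvPolynomial (Fin n × Fin 3) ℂ) (d : Fin n → ℕ),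
      F.IsWeightedHomogeneous (fun p : Fin n × Fin 3 => (Pi.single p.1 1 : Fin n → ℕ)) d ∧
      U = {B : Lines n | MvPolynomial.eval (fun p => (B p.1).rep p.2) F ≠ 0}}

/-- The space `{B ∈ ((ℂℙ²)^*)ⁿ | L(B) = L(A)}` of realizations of the lattice of `A`. -/
def Realization {n : ℕ} (A : Lines n) : Type := {B : Lines n // SameLattice A B}

instance {n : ℕ} (A : Lines n) : TopologicalSpace (Realization A) :=
  TopologicalSpace.induced Subtype.val (zariski n)

/-- Projective equivalence of realizations. -/
instance realizationSetoid {n : ℕ} (A : Lines n) : Setoid (Realization A) :=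
  Setoid.comap Subtype.val (projSetoid n)

/-- The moduli space `M_A = {B | L(B) = L(A)} / PGL(3, ℂ)`. -/
def Moduli {n : ℕ} (A : Lines n) : Type := Quotient (realizationSetoid A)

/-- The moduli space carries the quotient of the Zariski topology. -/
instance {n : ℕ} (A : Lines n) : TopologicalSpace (Moduli A) :=
  inferInstanceAs (TopologicalSpace (Quotient (realizationSetoid A)))

/-- The class in the moduli space of a realization. -/
def Moduli.mk {n : ℕ} {A : Lines n} (B : Realization A) : Moduli A :=
  Quotient.mk (realizationSetoid A) B

/-- Complex conjugation of coordinates, as a semilinear map. -/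
def conjV : V →ₛₗ[starRingEnd ℂ] V where
  toFun v := star v
  map_add' := star_add
  map_smul' := by
    intro c v
    ext j
    simp

theorem conjV_injective : Function.Injective conjV := star_injective

/-- The complex conjugate arrangement. -/
def conj {n : ℕ} (A : Lines n) : Lines n := fun i =>
  Projectivization.map conjV conjV_injective (A i)

/-- The quotient `M^c_A` of the moduli space by complex conjugation `[B] ↦ [conj B]`. -/
def ModuliConj {n : ℕ} (A : Lines n) : Type :=
  Quot fun m m' : Moduli A =>
    ∃ B B' : Realization A, Moduli.mk B = m ∧ Moduli.mk B' = m' ∧ B'.val = conj B.val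

/-- `M^c_A` carries the quotient topology. -/
instance {n : ℕ} (A : Lines n) : TopologicalSpace (ModuliConj A) :=
  inferInstanceAs (TopologicalSpace (Quot _))

/-- A point of the moduli space is real if it is the class of an arrangement of lines which are
all given by equations with real coefficients. -/
def IsRealPoint {n : ℕ} {A : Lines n} (m : Moduli A) : Prop :=
  ∃ B : Realization A, Moduli.mk B = m ∧
    ∀ i, ∃ (v : Fin 3 → ℝ) (h : (fun j => (v j : ℂ)) ≠ 0),
      B.val i = Projectivization.mk ℂ (fun j => (v j : ℂ)) h

/-- The lines with the given (nonzero) coefficient vectors. -/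
def ofCoeffs {n : ℕ} (c : Fin n → V) (h : ∀ i, c i ≠ 0) : Lines n :=
  fun i => Projectivization.mk ℂ (c i) (h i)

/-- Coefficients `[a, b, c]` of the factors `a x + b y + c z` of
`xyz(x-z)(y-z)(x-tz)(y-(1-t)z)(y-x-(1-t)z)(y-x+tz)(y-(2-t)x)`. -/
def coeffs₁ (t : ℂ) : Fin 10 → V :=
  ![![1, 0, 0], ![0, 1, 0], ![0, 0, 1], ![1, 0, -1], ![0, 1, -1], ![1, 0, -t],
    ![0, 1, -(1 - t)], ![-1, 1, -(1 - t)], ![-1, 1, t], ![-(2 - t), 1, 0]]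

/-- Coefficients of the factors of
`xyz(x-z)(y-z)(x-t₁z)(y-t₂z)(y-x)(y-(t₂-1)x-z)(y-(t₂-1)x-(1-t₁)z)`. -/
def coeffs₂ (t : ℂ × ℂ) : Fin 10 → V :=
  ![![1, 0, 0], ![0, 1, 0], ![0, 0, 1], ![1, 0, -1], ![0, 1, -1], ![1, 0, -t.1],
    ![0, 1, -t.2], ![-1, 1, 0], ![-(t.2 - 1), 1, -1], ![-(t.2 - 1), 1, -(1 - t.1)]]

/-- Coefficients of the factors of
`xyz(x-z)(y-z)(x-t²z)(y-tz)(y-x)(y+(1/t)x-tz)(y+(1/t)(x-z))`. -/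
def coeffs₃ (t : ℂ) : Fin 10 → V :=
  ![![1, 0, 0], ![0, 1, 0], ![0, 0, 1], ![1, 0, -1], ![0, 1, -1], ![1, 0, -t ^ 2],
    ![0, 1, -t], ![-1, 1, 0], ![1 / t, 1, -t], ![1 / t, 1, -(1 / t)]]

/-- Coefficients of the factors of
`xyz(x-z)(y-z)(x-(1+s/2)z)(y-(2+s)z)(y-x)(y-sx+sz)(y-sx-z)`. -/
def coeffs₄ (s : ℂ) : Fin 10 → V :=
  ![![1, 0, 0], ![0, 1, 0], ![0, 0, 1], ![1, 0, -1], ![0, 1, -1], ![1, 0, -(1 + s / 2)],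
    ![0, 1, -(2 + s)], ![-1, 1, 0], ![-s, 1, s], ![-s, 1, -1]]

theorem ne_zero_of_coord {v : V} (h : v 0 = 1 ∨ v 1 = 1 ∨ v 2 = 1) : v ≠ 0 := by
  rintro rfl
  simp at h

theorem coeffs₁_ne_zero (t : ℂ) (i : Fin 10) : coeffs₁ t i ≠ 0 := by
  apply ne_zero_of_coord
  fin_cases i <;> simp [coeffs₁]

theorem coeffs₂_ne_zero (t : ℂ × ℂ) (i : Fin 10) : coeffs₂ t i ≠ 0 := by
  apply ne_zero_of_coord
  fin_cases i <;> simp [coeffs₂]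

theorem coeffs₃_ne_zero (t : ℂ) (i : Fin 10) : coeffs₃ t i ≠ 0 := by
  apply ne_zero_of_coord
  fin_cases i <;> simp [coeffs₃]

theorem coeffs₄_ne_zero (s : ℂ) (i : Fin 10) : coeffs₄ s i ≠ 0 := by
  apply ne_zero_of_coord
  fin_cases i <;> simp [coeffs₄]

/-- The four families of arrangements. -/
def fam₁ (t : ℂ) : Lines 10 := ofCoeffs (coeffs₁ t) (coeffs₁_ne_zero t)
def fam₂ (t : ℂ × ℂ) : Lines 10 := ofCoeffs (coeffs₂ t) (coeffs₂_ne_zero t)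
def fam₃ (t : ℂ) : Lines 10 := ofCoeffs (coeffs₃ t) (coeffs₃_ne_zero t)
def fam₄ (s : ℂ) : Lines 10 := ofCoeffs (coeffs₄ s) (coeffs₄_ne_zero s)

/-- The admissible parameters of the four families. -/
def par₁ : Set ℂ := {t | t = (1 + (√5 : ℝ)) / 2 ∨ t = (1 - (√5 : ℝ)) / 2}
def par₂ : Set (ℂ × ℂ) :=
  {t | t.1 = (t.2 - 1) ^ 2 ∧ (t.2 - 1) ^ 3 - (t.2 - 1) ^ 2 + 1 = 0}
def par₃ : Set ℂ := {t | t = (-1 + (√5 : ℝ)) / 2 ∨ t = (-1 - (√5 : ℝ)) / 2}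
def par₄ : Set ℂ := {s | s = (√2 : ℝ) ∨ s = -(√2 : ℝ)}

/-- The realizations of the lattice of any member of the family are, up to projective equivalence,
exactly the members of the family; the moduli space has `k` points, of which `r` are real, and its
quotient by complex conjugation has `c` points. -/
def HasModuli {ι : Type} (fam : ι → Lines 10) (par : Set ι) (k r c : ℕ) : Prop :=
  ∀ t ∈ par,
    (∀ B : Lines 10, SameLattice (fam t) B ↔ ∃ s ∈ par, projSetoid 10 (fam s) B) ∧
    Nat.card (Moduli (fam t)) = k ∧
    Nat.card {m : Moduli (fam t) // IsRealPoint m} = r ∧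
    Nat.card (ModuliConj (fam t)) = c

end LineArrangement

end

open LineArrangement

/-!
Send the line through the two quadruple points to infinity and the quadruple points to the
directions of the axes. Of the nine other lines three are vertical and three horizontal. Every line
carries at least three multiple points, so the line at infinity carries a third one, and since it is
not a quadruple point, exactly two of the three remaining oblique lines are parallel. An affine
change of coordinates makes `x = 0`, `x = 1`, `y = 0`, `y = 1` part of the arrangement, which kills
the action of `PGL(3, ℂ)`.

The lattice is now determined by finitely many data: which intersection points of the vertical and
horizontal lines each oblique line passes through, and where the third oblique line meets the two
parallel ones. Non-reductivity leaves fourteen possibilities up to relabelling. For each of them the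
incidences are polynomial equations in the remaining coefficients. Four of the systems define the
four families, one defines an open subset of a rational curve, one a single point, two a pair of
complex conjugate points, and six have no admissible solution. The image of an irreducible curve and
a quotient with one point are irreducible.
-/

noncomputable section

namespace LineArrangement

open Projectivization

/-! ### Incidence and concurrency -/

theorem mem_plane_mk {u : V} (hu : u ≠ 0) (v : V) : v ∈ plane (mk ℂ u hu) ↔ u ⬝ᵥ v = 0 := by
  obtain ⟨a, ha⟩ := exists_smul_eq_mk_rep ℂ u hu
  change (mk ℂ u hu).rep ⬝ᵥ v = 0 ↔ _
  rw [← ha, smul_dotProduct, smul_eq_zero_iff_eq]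

theorem onLine_mk_left {v : V} (hv : v ≠ 0) (l : ℙ ℂ V) :
    OnLine (mk ℂ v hv) l ↔ v ∈ plane l := by
  rw [OnLine, submodule_mk, Submodule.span_singleton_le_iff_mem]

theorem onLine_mk_iff {u v : V} (hu : u ≠ 0) (hv : v ≠ 0) :
    OnLine (mk ℂ v hv) (mk ℂ u hu) ↔ u ⬝ᵥ v = 0 := by
  rw [onLine_mk_left, mem_plane_mk]

theorem onLine_iff_orthogonal {P l : ℙ ℂ V} : OnLine P l ↔ l.orthogonal P := by
  induction P with | h v hv =>
  induction l with | h u hu =>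
  rw [onLine_mk_iff, orthogonal_mk]

theorem eq_of_onLine {l m P Q : ℙ ℂ V} (h : l ≠ m) (hPl : OnLine P l) (hPm : OnLine P m)
    (hQl : OnLine Q l) (hQm : OnLine Q m) : P = Q := by
  rw [onLine_iff_orthogonal] at hPl hPm hQl hQm
  exact (Configuration.ofField.eq_or_eq_of_orthogonal hPl hPm hQl hQm).resolve_left h

/-- Three lines are concurrent if they have a common point. -/
def Conc (l m n : ℙ ℂ V) : Prop := ∃ P, OnLine P l ∧ OnLine P m ∧ OnLine P n

theorem conc_mk_iff {u v w : V} (hu : u ≠ 0) (hv : v ≠ 0) (hw : w ≠ 0) :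
    Conc (mk ℂ u hu) (mk ℂ v hv) (mk ℂ w hw) ↔ (Matrix.of ![u, v, w]).det = 0 := by
  have hmul (x : V) :
      (Matrix.of ![u, v, w]).mulVec x = 0 ↔ u ⬝ᵥ x = 0 ∧ v ⬝ᵥ x = 0 ∧ w ⬝ᵥ x = 0 := by
    simp [funext_iff, Fin.forall_fin_succ]
  rw [← Matrix.exists_mulVec_eq_zero_iff]
  constructor
  · rintro ⟨P, h⟩
    induction P with | h x hx =>
    simp only [onLine_mk_iff] at h
    exact ⟨x, hx, (hmul x).2 h⟩
  · rintro ⟨x, hx, h⟩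
    refine ⟨mk ℂ x hx, ?_⟩
    simpa only [onLine_mk_iff] using (hmul x).1 h

theorem Conc.rotate {l m n : ℙ ℂ V} (h : Conc l m n) : Conc m n l :=
  let ⟨P, hl, hm, hn⟩ := h; ⟨P, hm, hn, hl⟩

theorem Conc.swap {l m n : ℙ ℂ V} (h : Conc l m n) : Conc m l n :=
  let ⟨P, hl, hm, hn⟩ := h; ⟨P, hm, hl, hn⟩

theorem Conc.onLine {l m n P : ℙ ℂ V} (h : Conc l m n) (hlm : l ≠ m) (hl : OnLine P l)
    (hm : OnLine P m) : OnLine P n :=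
  let ⟨_, hl', hm', hn⟩ := h; eq_of_onLine hlm hl' hm' hl hm ▸ hn

theorem conc_rotate {l m n : ℙ ℂ V} : Conc l m n ↔ Conc m n l :=
  ⟨Conc.rotate, fun h => h.rotate.rotate⟩

theorem conc_swap {l m n : ℙ ℂ V} : Conc l m n ↔ Conc m l n := ⟨Conc.swap, Conc.swap⟩

theorem conc_self (l m : ℙ ℂ V) : Conc l l m := by
  induction l with | h a ha =>
  induction m with | h b hb =>
  rw [conc_mk_iff]
  exact Matrix.det_zero_of_row_eq (i := 0) (j := 1) (by decide) rfl

theorem exists_onLine (l m : ℙ ℂ V) : ∃ P, OnLine P l ∧ OnLine P m :=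
  let ⟨P, hl, _, hm⟩ := conc_self l m; ⟨P, hl, hm⟩

theorem conc_smul_iff (g : V ≃ₗ[ℂ] V) (l m n : ℙ ℂ V) :
    Conc (g • l) (g • m) (g • n) ↔ Conc l m n := by
  induction l with | h a ha =>
  induction m with | h b hb =>
  induction n with | h c hc =>
  have hmul : Matrix.of ![g • a, g • b, g • c] = Matrix.of ![a, b, c] *
      (LinearMap.toMatrix' (g : V →ₗ[ℂ] V)).transpose := by
    ext i j
    rw [Matrix.mul_apply_eq_vecMul, Matrix.vecMul_transpose, LinearMap.toMatrix'_mulVec]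
    fin_cases i <;> rfl
  rw [smul_mk, smul_mk, smul_mk, conc_mk_iff, conc_mk_iff, hmul, Matrix.det_mul,
    Matrix.det_transpose, LinearMap.det_toMatrix', mul_eq_zero,
    or_iff_left (LinearEquiv.isUnit_det' g).ne_zero]

/-! ### The intersection lattice -/

theorem finrank_plane (l : ℙ ℂ V) : Module.finrank ℂ (plane l) = 2 := by
  induction l with | h u hu =>
  have hker : plane (mk ℂ u hu) = LinearMap.ker (dotProductBilin ℂ ℂ u) := by
    ext v
    rw [mem_plane_mk, LinearMap.mem_ker, dotProductBilin_apply_apply]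
  have hne : dotProductBilin ℂ ℂ u ≠ 0 := fun h0 =>
    hu (dotProduct_eq_zero_iff.1 fun v => LinearMap.congr_fun h0 v)
  have hrank := Module.Dual.finrank_ker_add_one_of_ne_zero (f := dotProductBilin ℂ ℂ u) hne
  rw [Module.finrank_fin_fun] at hrank
  rw [hker]
  exact Nat.succ_injective hrank

section Lattice

variable {n : ℕ} {A B C : Lines n} {S : Finset (Fin n)} {i j : Fin n}

theorem mem_iInf_plane {v : V} :
    v ∈ (⨅ i ∈ S, plane (A i) : Submodule ℂ V) ↔ ∀ i ∈ S, v ∈ plane (A i) := by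
  simp only [Submodule.mem_iInf]

theorem interDim_eq_zero_iff : interDim A S = 0 ↔ ¬ ∃ P, ∀ i ∈ S, OnLine P (A i) := by
  rw [interDim, Submodule.finrank_eq_zero, Submodule.eq_bot_iff]
  constructor
  · rintro h ⟨P, hP⟩
    induction P with | h v hv =>
    exact hv (h v (mem_iInf_plane.2 fun i hi => (onLine_mk_left hv _).1 (hP i hi)))
  · intro h v hv
    by_contra h0
    exact h ⟨mk ℂ v h0, fun i hi => (onLine_mk_left h0 _).2 (mem_iInf_plane.1 hv i hi)⟩

theorem interDim_le_one (hi : i ∈ S) (hj : j ∈ S) (hij : A i ≠ A j) : interDim A S ≤ 1 := by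
  by_cases hP : ∃ P, ∀ k ∈ S, OnLine P (A k)
  · obtain ⟨P, hP⟩ := hP
    have hle : (⨅ k ∈ S, plane (A k) : Submodule ℂ V) ≤ P.submodule := by
      intro w hw
      rcases eq_or_ne w 0 with rfl | h0
      · exact zero_mem _
      have hQ (k) (hk : k ∈ S) := (onLine_mk_left h0 (A k)).2 (mem_iInf_plane.1 hw k hk)
      rw [← eq_of_onLine hij (hQ i hi) (hQ j hj) (hP i hi) (hP j hj), submodule_mk]
      exact Submodule.mem_span_singleton_self w
    exact (Submodule.finrank_mono hle).trans P.finrank_submodule.le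
  · exact (interDim_eq_zero_iff.2 hP).trans_le zero_le_one

theorem interDim_singleton (A : Lines n) (i : Fin n) : interDim A {i} = 2 := by
  rw [interDim, Finset.iInf_singleton, finrank_plane]

theorem exists_onLine_iff (hi : i ∈ S) (hj : j ∈ S) (hij : A i ≠ A j) :
    (∃ P, ∀ k ∈ S, OnLine P (A k)) ↔ ∀ k ∈ S, Conc (A i) (A j) (A k) := by
  refine ⟨fun ⟨P, hP⟩ k hk => ⟨P, hP i hi, hP j hj, hP k hk⟩, fun h => ?_⟩
  obtain ⟨P, hPi, hPj⟩ := exists_onLine (A i) (A j)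
  refine ⟨P, fun k hk => ?_⟩
  obtain ⟨Q, hQi, hQj, hQk⟩ := h k hk
  rwa [eq_of_onLine hij hPi hPj hQi hQj]

theorem interDim_comp (A : Lines n) (e : Equiv.Perm (Fin n)) (S : Finset (Fin n)) :
    interDim (A ∘ e) S = interDim A (S.map e.toEmbedding) := by
  rw [interDim, interDim, Finset.map_eq_image, Finset.iInf_finset_image]
  rfl

theorem SameLattice.trans (h : SameLattice A B) (h' : SameLattice B C) : SameLattice A C :=
  fun S hS => (h S hS).trans (h' S hS)

theorem SameLattice.injective (h : SameLattice A B) (hA : Function.Injective A) :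
    Function.Injective B := by
  intro i j hB
  by_contra hij
  have hA1 : interDim A {i, j} ≤ 1 := interDim_le_one (by simp) (by simp) (hA.ne hij)
  have hB2 : interDim B {i, j} = 2 := by
    rw [← interDim_singleton B i, interDim, interDim, Finset.iInf_insert, Finset.iInf_singleton,
      Finset.iInf_singleton, ← hB, inf_idem]
  rw [h _ (Finset.insert_nonempty i {j})] at hA1
  omega

theorem conc_iff_interDim_ne_zero {i j k : Fin n} :
    Conc (A i) (A j) (A k) ↔ interDim A {i, j, k} ≠ 0 := by
  rw [ne_eq, interDim_eq_zero_iff, not_not]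
  simp only [Conc, Finset.forall_mem_insert, Finset.mem_singleton, forall_eq]

theorem SameLattice.conc_iff (h : SameLattice A B) (i j k : Fin n) :
    Conc (A i) (A j) (A k) ↔ Conc (B i) (B j) (B k) := by
  rw [conc_iff_interDim_ne_zero, conc_iff_interDim_ne_zero, h _ (Finset.insert_nonempty i _)]

theorem sameLattice_of_conc_iff (hA : Function.Injective A) (hB : Function.Injective B)
    (h : ∀ i j k, Conc (A i) (A j) (A k) ↔ Conc (B i) (B j) (B k)) : SameLattice A B := by
  intro S hS
  obtain ⟨i, rfl⟩ | ⟨i, hi, j, hj, hij⟩ := hS.exists_eq_singleton_or_nontrivial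
  · rw [interDim_singleton, interDim_singleton]
  have hA1 := interDim_le_one hi hj (hA.ne hij)
  have hB1 := interDim_le_one hi hj (hB.ne hij)
  have h0 : interDim A S = 0 ↔ interDim B S = 0 := by
    rw [interDim_eq_zero_iff, interDim_eq_zero_iff, exists_onLine_iff hi hj (hA.ne hij),
      exists_onLine_iff hi hj (hB.ne hij)]
    simp only [h]
  omega

/-! ### Projective equivalence and complex conjugation -/

theorem projSetoid_iff : projSetoid n A B ↔ ∃ g : V ≃ₗ[ℂ] V, ∀ i, g • B i = A i := by
  change A ∈ MulAction.orbit _ B ↔ _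
  simp only [MulAction.mem_orbit_iff, funext_iff, Pi.smul_apply]

theorem sameLattice_of_proj (hA : Function.Injective A) (h : projSetoid n A B) :
    SameLattice A B := by
  obtain ⟨g, hg⟩ := projSetoid_iff.1 h
  refine sameLattice_of_conc_iff hA (fun i j hij => hA ?_) fun i j k => ?_
  · rw [← hg, ← hg, hij]
  · rw [← hg, ← hg, ← hg, conc_smul_iff]

/-- The complex conjugate `v ↦ star (g (star v))` of a linear automorphism `g`, through which
conjugation acts on projective equivalences. -/
def conjEquiv (g : V ≃ₗ[ℂ] V) : V ≃ₗ[ℂ] V where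
  toFun v := star (g (star v))
  map_add' u v := by simp only [star_add, map_add]
  map_smul' c v := by simp only [star_smul, map_smul, star_star, RingHom.id_apply]
  invFun v := star (g.symm (star v))
  left_inv v := by simp only [star_star, LinearEquiv.symm_apply_apply]
  right_inv v := by simp only [star_star, LinearEquiv.apply_symm_apply]

theorem projSetoid_conj (h : projSetoid n A B) : projSetoid n (conj A) (conj B) := by
  rw [projSetoid_iff] at *
  obtain ⟨g, hg⟩ := h
  refine ⟨conjEquiv g, fun i => ?_⟩
  simp only [conj, ← hg]
  induction B i with | h v hv =>
  rw [map_mk, smul_mk, smul_mk, map_mk]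
  congr 1
  change star (g (star (star v))) = star (g v)
  rw [star_star]

end Lattice

/-! ### Normal form -/

theorem mk_eq_of_smul {v w : V} {hv : v ≠ 0} {hw : w ≠ 0} (c : ℂ) (h : ∀ i, c * w i = v i) :
    mk ℂ v hv = mk ℂ w hw := by
  rw [mk_eq_mk_iff']
  exact ⟨c, funext h⟩

/-- The line `x = s z`. -/
def vertical (s : ℂ) : ℙ ℂ V := mk ℂ ![1, 0, -s] (ne_zero_of_coord (by simp))

/-- The line `y = t z`. -/
def horizontal (t : ℂ) : ℙ ℂ V := mk ℂ ![0, 1, -t] (ne_zero_of_coord (by simp))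

/-- The line `y = κ x + γ z`. -/
def oblique (κ γ : ℂ) : ℙ ℂ V := mk ℂ ![-κ, 1, -γ] (ne_zero_of_coord (by simp))

/-- The line at infinity `z = 0`. -/
def infinity : ℙ ℂ V := mk ℂ ![0, 0, 1] (ne_zero_of_coord (by simp))

theorem exists_eq_vertical {l : ℙ ℂ V} (h : Conc (vertical 0) l infinity) (hl : l ≠ infinity) :
    ∃ s, l = vertical s := by
  induction l with | h w hw =>
  rw [vertical, infinity, conc_mk_iff] at h
  have hw1 : w 1 = 0 := by simpa [Matrix.det_fin_three] using h
  have hw0 : w 0 ≠ 0 := fun hw0 => hl <| mk_eq_of_smul (w 2) fun i => by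
    fin_cases i <;> simp [hw0, hw1]
  refine ⟨-(w 2 / w 0), mk_eq_of_smul (w 0) fun i => ?_⟩
  fin_cases i <;> simp [hw1, mul_div_cancel₀, hw0]

theorem exists_eq_horizontal {l : ℙ ℂ V} (h : Conc (horizontal 0) l infinity)
    (hl : l ≠ infinity) : ∃ t, l = horizontal t := by
  induction l with | h w hw =>
  rw [horizontal, infinity, conc_mk_iff] at h
  have hw0 : w 0 = 0 := by simpa [Matrix.det_fin_three] using h
  have hw1 : w 1 ≠ 0 := fun hw1 => hl <| mk_eq_of_smul (w 2) fun i => by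
    fin_cases i <;> simp [hw0, hw1]
  refine ⟨-(w 2 / w 1), mk_eq_of_smul (w 1) fun i => ?_⟩
  fin_cases i <;> simp [hw0, mul_div_cancel₀, hw1]

theorem exists_eq_oblique {l : ℙ ℂ V} (hc : ¬ Conc (vertical 0) l infinity)
    (hr : ¬ Conc (horizontal 0) l infinity) : ∃ κ γ, κ ≠ 0 ∧ l = oblique κ γ := by
  induction l with | h w hw =>
  rw [vertical, infinity, conc_mk_iff] at hc
  rw [horizontal, infinity, conc_mk_iff] at hr
  have hw1 : w 1 ≠ 0 := by simpa [Matrix.det_fin_three] using hc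
  have hw0 : w 0 ≠ 0 := by simpa [Matrix.det_fin_three] using hr
  refine ⟨-(w 0 / w 1), -(w 2 / w 1), by simp [hw0, hw1], mk_eq_of_smul (w 1) fun i => ?_⟩
  fin_cases i <;> simp [mul_div_cancel₀, hw1]

theorem conc_oblique_infinity_iff {κ κ' γ γ' : ℂ} :
    Conc (oblique κ γ) (oblique κ' γ') infinity ↔ κ = κ' := by
  rw [infinity, oblique, oblique, conc_mk_iff]
  simp [Matrix.det_fin_three, neg_add_eq_zero]

theorem exists_smul_eq_axes {l m n : ℙ ℂ V} (h : ¬ Conc l m n) :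
    ∃ g : V ≃ₗ[ℂ] V, g • l = vertical 0 ∧ g • m = horizontal 0 ∧ g • n = infinity := by
  induction l with | h u hu =>
  induction m with | h v hv =>
  induction n with | h w hw =>
  rw [conc_mk_iff] at h
  have hli : LinearIndependent ℂ ![u, v, w] := Matrix.linearIndependent_rows_of_det_ne_zero h
  let b := basisOfLinearIndependentOfCardEqFinrank hli (by simp)
  have hb (i : Fin 3) : b.equivFun (![u, v, w] i) = Pi.single i 1 := by
    rw [← congrFun (coe_basisOfLinearIndependentOfCardEqFinrank hli (by simp)) i]
    ext j
    rw [b.equivFun_self i j, Pi.single_apply]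
    simp [eq_comm]
  refine ⟨b.equivFun, ?_, ?_, ?_⟩ <;> rw [smul_mk] <;> refine mk_eq_of_smul 1 fun j => ?_
  · refine Eq.trans ?_ (congrFun (hb 0) j).symm
    fin_cases j <;> simp
  · refine Eq.trans ?_ (congrFun (hb 1) j).symm
    fin_cases j <;> simp
  · refine Eq.trans ?_ (congrFun (hb 2) j).symm
    fin_cases j <;> simp

/-- The action on lines of rescaling the two affine coordinates: it divides positions of vertical
lines by `p` and positions of horizontal lines by `r`. -/
def scaling (p r : ℂˣ) : V ≃ₗ[ℂ] V :=
  LinearEquiv.piCongrRight fun i => LinearEquiv.smulOfUnit (![p, r, 1] i)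

theorem scaling_apply (p r : ℂˣ) (v : V) : scaling p r • v = ![p * v 0, r * v 1, v 2] := by
  ext i
  change (![p, r, 1] i : ℂˣ) • v i = _
  fin_cases i <;> simp [Units.smul_def]

theorem scaling_smul_vertical (p r : ℂˣ) (s : ℂ) :
    scaling p r • vertical (p * s) = vertical s := by
  simp only [vertical, smul_mk, scaling_apply]
  refine mk_eq_of_smul p fun i => ?_
  fin_cases i <;> simp

theorem scaling_smul_horizontal (p r : ℂˣ) (t : ℂ) :
    scaling p r • horizontal (r * t) = horizontal t := by
  simp only [horizontal, smul_mk, scaling_apply]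
  refine mk_eq_of_smul r fun i => ?_
  fin_cases i <;> simp

theorem scaling_smul_infinity (p r : ℂˣ) : scaling p r • infinity = infinity := by
  simp only [infinity, smul_mk, scaling_apply]
  refine mk_eq_of_smul 1 fun i => ?_
  fin_cases i <;> simp

/-- The roles of the lines: `col` and `row` are the lines through the first, respectively second,
quadruple point, `inf` is the line through both, and `obl` are the remaining three lines, of which
`obl 0` and `obl 1` meet on `inf`. -/
inductive Label
  | col (i : Fin 3)
  | row (j : Fin 3)
  | inf
  | obl (k : Fin 3)
  deriving DecidableEq, Fintype

open Label

/-- Two labels other than `inf` have the same direction if the lines meet on `inf`. -/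
def Label.dir : Label → Fin 5
  | col _ => 0
  | row _ => 1
  | inf => 4
  | obl k => ![2, 2, 3] k

/-- The incidences on the line `inf`. They make it possible to choose affine coordinates such that
the lines `col` are vertical, the lines `row` are horizontal and `inf` is the line at infinity. -/
structure Base (X : Label → ℙ ℂ V) : Prop where
  inj : Function.Injective X
  conc_inf_iff : ∀ {x y}, x ≠ inf → y ≠ inf → (Conc (X x) (X y) (X inf) ↔ x.dir = y.dir)

section Base

variable {X : Label → ℙ ℂ V}

theorem Base.smul (hX : Base X) (g : V ≃ₗ[ℂ] V) : Base (fun l => g • X l) where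
  inj _ _ h := hX.inj (MulAction.injective g h)
  conc_inf_iff hx hy := (conc_smul_iff g _ _ _).trans (hX.conc_inf_iff hx hy)

theorem Base.conc_col (hX : Base X) (i i' : Fin 3) : Conc (X (col i)) (X (col i')) (X inf) :=
  (hX.conc_inf_iff (by simp) (by simp)).2 rfl

theorem Base.conc_row (hX : Base X) (j j' : Fin 3) : Conc (X (row j)) (X (row j')) (X inf) :=
  (hX.conc_inf_iff (by simp) (by simp)).2 rfl

theorem Base.not_conc (hX : Base X) {x y : Label} (hx : x ≠ inf) (hy : y ≠ inf)
    (h : x.dir ≠ y.dir) : ¬ Conc (X x) (X y) (X inf) :=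
  mt (hX.conc_inf_iff hx hy).1 h

theorem Base.exists_smul_eq_frame (hX : Base X) :
    ∃ g : V ≃ₗ[ℂ] V, g • X (col 0) = vertical 0 ∧ g • X (col 1) = vertical 1 ∧
      g • X (row 0) = horizontal 0 ∧ g • X (row 1) = horizontal 1 ∧ g • X inf = infinity := by
  obtain ⟨g, hc0, hr0, hinf⟩ := exists_smul_eq_axes (hX.not_conc (x := col 0) (y := row 0)
    (by simp) (by simp) (by decide))
  have hY := hX.smul g
  obtain ⟨p, hc1⟩ := exists_eq_vertical (hc0 ▸ hinf ▸ hY.conc_col 0 1)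
    (hinf ▸ hY.inj.ne (by simp))
  obtain ⟨r, hr1⟩ := exists_eq_horizontal (hr0 ▸ hinf ▸ hY.conc_row 0 1)
    (hinf ▸ hY.inj.ne (by simp))
  have hp : p ≠ 0 := by
    rintro rfl
    exact hY.inj.ne (a₁ := col 1) (a₂ := col 0) (by simp) (hc1.trans hc0.symm)
  have hr : r ≠ 0 := by
    rintro rfl
    exact hY.inj.ne (a₁ := row 1) (a₂ := row 0) (by simp) (hr1.trans hr0.symm)
  lift p to ℂˣ using hp.isUnit
  lift r to ℂˣ using hr.isUnit
  refine ⟨scaling p r * g, ?_, ?_, ?_, ?_, ?_⟩ <;> rw [mul_smul]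
  · simpa only [hc0, mul_zero] using scaling_smul_vertical p r 0
  · simpa only [hc1, mul_one] using scaling_smul_vertical p r 1
  · simpa only [hr0, mul_zero] using scaling_smul_horizontal p r 0
  · simpa only [hr1, mul_one] using scaling_smul_horizontal p r 1
  · rw [hinf, scaling_smul_infinity]

/-- The parameters of an arrangement in normal form: the lines are `x = 0`, `x = z`, `x = s z`,
`y = 0`, `y = z`, `y = t z`, `z = 0`, `y = κ x + γ₀ z`, `y = κ x + γ₁ z` and `y = μ x + ν z`. -/
@[ext]
structure Param where
  (s t κ γ₀ γ₁ μ ν : ℂ)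

namespace Param

variable (q : Param)

/-- The positions of the vertical lines. -/
def a : Fin 3 → ℂ := ![0, 1, q.s]

/-- The positions of the horizontal lines. -/
def b : Fin 3 → ℂ := ![0, 1, q.t]

/-- The slopes of the oblique lines. -/
def slope : Fin 3 → ℂ := ![q.κ, q.κ, q.μ]

/-- The intercepts of the oblique lines. -/
def icept : Fin 3 → ℂ := ![q.γ₀, q.γ₁, q.ν]

/-- The coefficients of the lines of an arrangement in normal form. -/
def coef : Label → V
  | col i => ![1, 0, -q.a i]
  | row j => ![0, 1, -q.b j]
  | inf => ![0, 0, 1]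
  | obl k => ![-q.slope k, 1, -q.icept k]

theorem coef_ne_zero (l : Label) : q.coef l ≠ 0 := by
  apply ne_zero_of_coord
  cases l <;> simp [coef]

/-- The arrangement in normal form. -/
def lines (l : Label) : ℙ ℂ V := Projectivization.mk ℂ (q.coef l) (q.coef_ne_zero l)

/-- Nondegeneracy of the parameters: the ten lines are distinct, no oblique line is vertical or
horizontal, and the third one is not parallel to the first two. -/
structure Good : Prop where
  s0 : q.s ≠ 0
  s1 : q.s ≠ 1
  t0 : q.t ≠ 0
  t1 : q.t ≠ 1
  κ0 : q.κ ≠ 0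
  μ0 : q.μ ≠ 0
  γ : q.γ₀ ≠ q.γ₁
  κμ : q.κ ≠ q.μ

theorem conc_iff (x y z : Label) : Conc (q.lines x) (q.lines y) (q.lines z) ↔
    (Matrix.of ![q.coef x, q.coef y, q.coef z]).det = 0 :=
  conc_mk_iff _ _ _

theorem Good.slope_ne_zero (h : q.Good) (k : Fin 3) : q.slope k ≠ 0 := by
  fin_cases k
  exacts [h.κ0, h.κ0, h.μ0]

theorem Good.a_injective (h : q.Good) : Function.Injective q.a := by
  intro i i'
  have := h.s0
  have := h.s1
  fin_cases i <;> fin_cases i' <;> simp [a] <;> grind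

theorem Good.b_injective (h : q.Good) : Function.Injective q.b := by
  intro j j'
  have := h.t0
  have := h.t1
  fin_cases j <;> fin_cases j' <;> simp [b] <;> grind

theorem Good.eq_of_slope_eq_of_icept_eq (h : q.Good) {k l : Fin 3} (hs : q.slope k = q.slope l)
    (hi : q.icept k = q.icept l) : k = l := by
  have := h.κμ
  have := h.γ
  fin_cases k <;> fin_cases l <;> simp_all [slope, icept]

theorem Good.lines_injective (h : q.Good) : Function.Injective q.lines := by
  intro x y hxy
  rw [lines, lines, Projectivization.mk_eq_mk_iff'] at hxy
  obtain ⟨c, hc⟩ := hxy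
  have hmul (i : Fin 3) : c * q.coef y i = q.coef x i := congrFun hc i
  have h0 := hmul 0
  have h1 := hmul 1
  have h2 := hmul 2
  have hslope := h.slope_ne_zero
  rcases x with i | i | _ | i <;> rcases y with j | j | _ | j <;>
    simp only [coef, Matrix.cons_val] at h0 h1 h2 <;>
    grind [h.a_injective.eq_iff, h.b_injective.eq_iff, h.eq_of_slope_eq_of_icept_eq]

theorem Good.slope_eq_iff (h : q.Good) (k l : Fin 3) :
    q.slope k = q.slope l ↔ (obl k).dir = (obl l).dir := by
  have := h.κμ
  fin_cases k <;> fin_cases l <;> simp_all [slope, dir, eq_comm]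

theorem conc_inf_iff (x y : Label) : Conc (q.lines x) (q.lines y) (q.lines inf) ↔
    q.coef x 0 * q.coef y 1 = q.coef x 1 * q.coef y 0 := by
  rw [conc_iff, show q.coef inf = ![0, 0, 1] from rfl]
  simp [Matrix.det_fin_three, sub_eq_zero]

theorem Good.base (h : q.Good) : Base q.lines where
  inj := h.lines_injective
  conc_inf_iff {x y} hx hy := by
    have hslope := h.slope_ne_zero
    have hdir (k : Fin 3) : (obl k).dir ≠ 0 ∧ (obl k).dir ≠ 1 := by decide +revert
    rw [conc_inf_iff]
    rcases x with i | i | _ | i <;> rcases y with j | j | _ | j <;>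
      simp only [coef, Matrix.cons_val] <;> grind [h.slope_eq_iff, dir]

end Param

theorem Base.exists_param (hX : Base X) :
    ∃ (g : V ≃ₗ[ℂ] V) (q : Param), q.Good ∧ ∀ l, g • X l = q.lines l := by
  obtain ⟨g, hc0, hc1, hr0, hr1, hinf⟩ := hX.exists_smul_eq_frame
  have hY := hX.smul g
  have hne {x y : Label} {l : ℙ ℂ V} (hx : g • X x = l) (hy : g • X y = l) : x = y :=
    hY.inj (hx.trans hy.symm)
  obtain ⟨s, hc2⟩ := exists_eq_vertical (hc0 ▸ hinf ▸ hY.conc_col 0 2)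
    (hinf ▸ hY.inj.ne (by simp))
  obtain ⟨t, hr2⟩ := exists_eq_horizontal (hr0 ▸ hinf ▸ hY.conc_row 0 2)
    (hinf ▸ hY.inj.ne (by simp))
  have hobl (k : Fin 3) : ∃ κ γ, κ ≠ 0 ∧ g • X (obl k) = oblique κ γ :=
    exists_eq_oblique
      (hc0 ▸ hinf ▸ hY.not_conc (x := col 0) (by simp) (by simp) (by decide +revert))
      (hr0 ▸ hinf ▸ hY.not_conc (x := row 0) (by simp) (by simp) (by decide +revert))
  obtain ⟨κ, γ₀, hκ, ho0⟩ := hobl 0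
  obtain ⟨κ', γ₁, -, ho1⟩ := hobl 1
  obtain ⟨μ, ν, hμ, ho2⟩ := hobl 2
  obtain rfl : κ = κ' := by
    have hpar := (hY.conc_inf_iff (x := obl 0) (y := obl 1) (by simp) (by simp)).2 rfl
    rwa [hinf, ho0, ho1, conc_oblique_infinity_iff] at hpar
  have hκμ : κ ≠ μ := by
    have hnpar := hY.not_conc (x := obl 0) (y := obl 2) (by simp) (by simp) (by decide)
    rwa [hinf, ho0, ho2, conc_oblique_infinity_iff] at hnpar
  refine ⟨g, ⟨s, t, κ, γ₀, γ₁, μ, ν⟩, ⟨?_, ?_, ?_, ?_, hκ, hμ, ?_, hκμ⟩, ?_⟩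
  · rintro rfl; simpa using hne hc2 hc0
  · rintro rfl; simpa using hne hc2 hc1
  · rintro rfl; simpa using hne hr2 hr0
  · rintro rfl; simpa using hne hr2 hr1
  · intro (h : γ₀ = γ₁)
    subst h
    simpa using hne ho0 ho1
  · rintro (i | j | _ | k)
    · fin_cases i <;> assumption
    · fin_cases j <;> assumption
    · exact hinf
    · fin_cases k <;> assumption

end Base

/-! ### Codes -/

/-- The grid points on an oblique line: the value at `i` is `some j` if the line passes through the
intersection of `col i` and `row j`, and `none` if there is no such `j`. -/
abbrev Trace := Fin 3 → Option (Fin 3)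

namespace Trace

/-- Each row contains at most one of the grid points. -/
abbrev Inj (f : Trace) : Prop := ∀ i i', f i ≠ none → f i = f i' → i = i'

/-- The two lines have no grid point in common. -/
abbrev Disj (f g : Trace) : Prop := ∀ i, f i ≠ none → f i ≠ g i

/-- None of the grid points lies on the given column or row. -/
abbrev Avoids (f : Trace) (o : Option (Fin 3 ⊕ Fin 3)) : Prop :=
  ∀ i, f i ≠ none → o ≠ some (.inl i) ∧ o ≠ (f i).map .inr

/-- The traces which remain after permuting the columns and the rows. -/
def normal : List Trace :=
  [![some 0, some 1, some 2], ![some 0, some 1, none], ![some 0, none, none]]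

theorem Inj.exists_perm_mem_normal : ∀ {f : Trace}, f.Inj → (∃ i, f i ≠ none) →
    ∃ s t : Equiv.Perm (Fin 3), (fun i => (f (s i)).map t.symm) ∈ normal := by
  decide +kernel

end Trace

/-- A code records the points outside `inf` which lie on three lines of an arrangement. The trace of
`obl k` is `cell k`. If `obl b` and `obl 2` meet on `col i` or on `row j`, then `meet b` is
`some (.inl i)` or `some (.inr j)`, and otherwise it is `none`. -/
@[ext]
structure Code where
  cell : Fin 3 → Trace
  meet : Fin 2 → Option (Fin 3 ⊕ Fin 3)

instance : DecidableEq Code := fun _ _ => decidable_of_iff' _ Code.ext_iff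

namespace Code

/-- The code of the arrangement in which the columns and the rows are exchanged. -/
def transpose (c : Code) : Code where
  cell k j := Fin.find? fun i => c.cell k i = some j
  meet b := (c.meet b).map Sum.swap

/-- Exchange of the first two indices. -/
def exchange {n : ℕ} (sw : Bool) : Equiv.Perm (Fin (n + 2)) := bif sw then Equiv.swap 0 1 else 1

/-- The code of the arrangement in which the columns are permuted by `s` and the rows by `t`, and
in which `obl 0` and `obl 1` are exchanged if `sw` is true. -/
def permute (sw : Bool) (s t : Equiv.Perm (Fin 3)) (c : Code) : Code where
  cell k i := (c.cell (exchange sw k) (s i)).map t.symm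
  meet b := (c.meet (exchange sw b)).map (Sum.map s.symm t.symm)

/-- Every line contains three multiple points. For a line other than `obl 2`, one of them may be the
point at which it meets `inf`. -/
structure Rich (c : Code) : Prop where
  col : ∀ i, 2 ≤ Finset.card {k | c.cell k i ≠ none} + Finset.card {b | c.meet b = some (.inl i)}
  row : ∀ j, 2 ≤ Finset.card {k | ∃ i, c.cell k i = some j} +
    Finset.card {b | c.meet b = some (.inr j)}
  obl : ∀ b : Fin 2, 2 ≤ Finset.card {i | c.cell b.castSucc i ≠ none} +
    if c.meet b = none then 0 else 1
  obl_two : 3 ≤ Finset.card {i | c.cell 2 i ≠ none} + Finset.card {b | c.meet b ≠ none}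

instance (c : Code) : Decidable c.Rich :=
  decidable_of_iff (_ ∧ _ ∧ _ ∧ _)
    ⟨fun ⟨h₁, h₂, h₃, h₄⟩ => ⟨h₁, h₂, h₃, h₄⟩, fun ⟨h₁, h₂, h₃, h₄⟩ => ⟨h₁, h₂, h₃, h₄⟩⟩

/-- Necessary conditions on the code of an arrangement in which no point outside `inf` lies on four
lines and every line contains three multiple points. -/
structure Admissible (c : Code) : Prop where
  inj : ∀ k, (c.cell k).Inj
  disj : ∀ k k', k ≠ k' → (c.cell k).Disj (c.cell k')
  avoids : ∀ b : Fin 2, (c.cell b.castSucc).Avoids (c.meet b) ∧ (c.cell 2).Avoids (c.meet b)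
  meet_inj : c.meet 0 ≠ none → c.meet 0 ≠ c.meet 1
  rich : c.Rich

/-- The code of the first family. -/
def code₁ : Code where
  cell := ![![some 2, none, some 1], ![none, some 2, some 0], ![some 0, none, none]]
  meet := ![some (.inl 1), some (.inr 1)]

/-- The code of the second family. -/
def code₂ : Code where
  cell := ![![some 1, some 2, none], ![none, none, some 0], ![some 0, some 1, none]]
  meet := ![some (.inl 2), some (.inr 2)]

/-- The code of the third family. -/
def code₃ : Code where
  cell := ![![some 2, none, some 0], ![none, some 0, some 1], ![some 0, some 1, none]]
  meet := ![none, some (.inr 2)]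

/-- The code of the fourth family. -/
def code₄ : Code where
  cell := ![![none, some 0, some 1], ![some 1, none, some 2], ![some 0, some 1, none]]
  meet := ![some (.inr 2), none]

/-- The code of a one-parameter family of arrangements. -/
def codeCurve : Code where
  cell := ![![some 1, some 0, none], ![some 2, none, some 0], ![some 0, some 1, some 2]]
  meet := ![none, none]

/-- The code of a single arrangement up to projective equivalence. -/
def codePoint : Code where
  cell := ![![some 1, some 0, some 2], ![none, none, some 0], ![some 0, some 1, none]]
  meet := ![none, some (.inr 2)]

/-- The code of a pair of complex conjugate arrangements. -/
def codePair₁ : Code where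
  cell := ![![some 1, some 2, some 0], ![none, none, some 1], ![some 0, some 1, none]]
  meet := ![none, some (.inr 2)]

/-- The code of another pair of complex conjugate arrangements. -/
def codePair₂ : Code where
  cell := ![![some 2, some 1, none], ![none, some 0, some 1], ![some 0, none, none]]
  meet := ![some (.inl 2), some (.inr 2)]

/-- An admissible code of no complex arrangement. -/
def codeEmpty₁ : Code where
  cell := ![![some 1, some 2, none], ![none, some 0, some 1], ![some 0, some 1, none]]
  meet := ![some (.inl 2), some (.inr 2)]

/-- An admissible code of no complex arrangement. -/
def codeEmpty₂ : Code where
  cell := ![![some 1, some 2, none], ![none, some 0, some 1], ![some 0, some 1, some 2]]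
  meet := ![none, none]

/-- An admissible code of no complex arrangement. -/
def codeEmpty₃ : Code where
  cell := ![![some 1, some 0, none], ![some 2, none, some 1], ![some 0, some 1, some 2]]
  meet := ![none, none]

/-- An admissible code of no complex arrangement. -/
def codeEmpty₄ : Code where
  cell := ![![some 1, some 2, some 0], ![none, some 0, some 1], ![some 0, some 1, none]]
  meet := ![none, some (.inr 2)]

/-- An admissible code of no complex arrangement. -/
def codeEmpty₅ : Code where
  cell := ![![some 1, some 2, some 0], ![none, some 0, some 1], ![some 0, some 1, some 2]]
  meet := ![none, none]

/-- An admissible code of no complex arrangement. -/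
def codeEmpty₆ : Code where
  cell := ![![some 1, some 2, some 0], ![some 2, some 0, some 1], ![some 0, some 1, some 2]]
  meet := ![none, none]

/-- Representatives of the admissible codes up to relabelling. -/
def all : List Code :=
  [code₁, code₂, code₃, code₄, codeCurve, codePoint, codePair₁, codePair₂, codeEmpty₁, codeEmpty₂,
    codeEmpty₃, codeEmpty₄, codeEmpty₅, codeEmpty₆]

-- Restricting `s` and `t` to the symmetries of `h` only shortens the kernel computation.
set_option synthInstance.maxHeartbeats 400000 in
-- The instance deciding this statement is nested as deeply as its quantifiers.
set_option synthInstance.maxSize 10000 in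
set_option maxRecDepth 100000 in
theorem exists_permute_mk_mem_all : ∀ h ∈ Trace.normal, ∀ f : Trace, f.Inj → f.Disj h →
    ∀ g : Trace, g.Inj → g.Disj h → f.Disj g → ∀ o, f.Avoids o → h.Avoids o →
    ∀ p, g.Avoids p → h.Avoids p → (o ≠ none → o ≠ p) → Rich ⟨![f, g, h], ![o, p]⟩ →
    ∃ s t : Equiv.Perm (Fin 3), (∀ i, (h (s i)).map t.symm = h i) ∧ ∃ sw,
      permute sw s t ⟨![f, g, h], ![o, p]⟩ ∈ all ∨
        permute sw s t (transpose ⟨![f, g, h], ![o, p]⟩) ∈ all := by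
  decide +kernel

theorem Admissible.exists_permute_mem_all {c : Code} (hc : c.Admissible)
    (h : c.cell 2 ∈ Trace.normal) :
    ∃ sw s t, permute sw s t c ∈ all ∨ permute sw s t c.transpose ∈ all := by
  have hmk : c = ⟨![c.cell 0, c.cell 1, c.cell 2], ![c.meet 0, c.meet 1]⟩ :=
    Code.ext (funext fun k => by fin_cases k <;> rfl) (funext fun b => by fin_cases b <;> rfl)
  obtain ⟨s, t, -, sw, hst⟩ := exists_permute_mk_mem_all _ h _ (hc.inj 0)
    (hc.disj 0 2 (by decide)) _ (hc.inj 1) (hc.disj 1 2 (by decide)) (hc.disj 0 1 (by decide)) _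
    (hc.avoids 0).1 (hc.avoids 0).2 _ (hc.avoids 1).1 (hc.avoids 1).2 hc.meet_inj (hmk ▸ hc.rich)
  exact ⟨sw, s, t, hmk ▸ hst⟩

end Code

/-! ### The code of an arrangement -/

/-- A label as a value of `Code.meet`. -/
abbrev Label.axis : Fin 3 ⊕ Fin 3 → Label := Sum.elim col row

/-- The arrangement `X` has the code `c`. -/
structure HasCode (X : Label → ℙ ℂ V) (c : Code) : Prop where
  cell : ∀ k i j, Conc (X (col i)) (X (row j)) (X (obl k)) ↔ c.cell k i = some j
  meet : ∀ b x, Conc (X (axis x)) (X (obl (Fin.castSucc b))) (X (obl 2)) ↔ c.meet b = some x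

theorem triple_induction {α β : Type*} [LinearOrder β] (f : α → β) {P : α → α → α → Prop}
    (swap : ∀ {x y z}, P x y z → P y x z) (rotate : ∀ {x y z}, P x y z → P y z x)
    (sorted : ∀ x y z, f x ≤ f y → f y ≤ f z → P x y z) (x y z : α) : P x y z := by
  wlog hxy : f x ≤ f y generalizing x y
  · exact swap (this y x (le_of_not_ge hxy))
  obtain hyz | hzy := le_total (f y) (f z)
  · exact sorted x y z hxy hyz
  obtain hxz | hzx := le_total (f x) (f z)
  · exact rotate (swap (sorted x z y hxz hzy))
  · exact rotate (sorted z x y hzx hxy)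

theorem Label.cases_of_dir_lt : ∀ {x y z : Label}, x.dir < y.dir → y.dir < z.dir → z ≠ inf →
    (∃ i j k, x = col i ∧ y = row j ∧ z = obl k) ∨
      ∃ (e : Fin 3 ⊕ Fin 3) (b : Fin 2), x = axis e ∧ y = obl b.castSucc ∧ z = obl 2 := by
  decide +kernel

theorem Label.dir_obl_castSucc : ∀ b : Fin 2, (obl b.castSucc).dir = 2 := by decide

theorem Label.eq_inf_of_dir_eq : ∀ {x : Label}, x.dir = inf.dir → x = inf := by
  decide

namespace Base

variable {X Y : Label → ℙ ℂ V} {x y z : Label} {P : ℙ ℂ V}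

theorem conc_iff_of_dir_eq (hX : Base X) (hxy : x ≠ y) (hx : x ≠ inf) (hy : y ≠ inf) (hz : z ≠ inf)
    (h : x.dir = y.dir) : Conc (X x) (X y) (X z) ↔ x.dir = z.dir := by
  obtain ⟨R, hRx, hRy, hRi⟩ := (hX.conc_inf_iff hx hy).2 h
  rw [← hX.conc_inf_iff hx hz]
  exact ⟨fun hc => ⟨R, hRx, hc.onLine (hX.inj.ne hxy) hRx hRy, hRi⟩, fun hc =>
    ⟨R, hRx, hRy, hc.swap.rotate.onLine (hX.inj.ne hx) hRx hRi⟩⟩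

theorem conc_congr (hX : Base X) (hY : Base Y) {c : Code} (hXc : HasCode X c) (hYc : HasCode Y c)
    (x y z : Label) : Conc (X x) (X y) (X z) ↔ Conc (Y x) (Y y) (Y z) := by
  refine triple_induction Label.dir (P := fun x y z => Conc (X x) (X y) (X z) ↔
    Conc (Y x) (Y y) (Y z)) ?_ ?_ ?_ x y z
  · intro x y z h
    rwa [conc_swap, conc_swap (l := Y y)]
  · intro x y z h
    rwa [← conc_rotate, ← conc_rotate (l := Y x)]
  intro x y z hxy hyz
  by_cases hx : x = y
  · simp only [hx, conc_self]
  by_cases hz : z = y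
  · simp only [hz, conc_rotate (l := X x), conc_rotate (l := Y x), conc_self]
  have hne {x y : Label} (h : x ≠ y) (hxy : x.dir ≤ y.dir) : x ≠ inf := by
    rintro rfl
    exact h (Label.eq_inf_of_dir_eq (le_antisymm (by decide +revert) hxy)).symm
  have hxi := hne hx hxy
  have hyi := hne (Ne.symm hz) hyz
  by_cases hzi : z = inf
  · rw [hzi, hX.conc_inf_iff hxi hyi, hY.conc_inf_iff hxi hyi]
  obtain hxy' | hxy' := hxy.eq_or_lt
  · rw [hX.conc_iff_of_dir_eq hx hxi hyi hzi hxy', hY.conc_iff_of_dir_eq hx hxi hyi hzi hxy']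
  obtain hyz' | hyz' := hyz.eq_or_lt
  · rw [conc_rotate, hX.conc_iff_of_dir_eq (Ne.symm hz) hyi hzi hxi hyz', conc_rotate (l := Y x),
      hY.conc_iff_of_dir_eq (Ne.symm hz) hyi hzi hxi hyz']
  obtain ⟨i, j, k, rfl, rfl, rfl⟩ | ⟨e, b, rfl, rfl, rfl⟩ := Label.cases_of_dir_lt hxy' hyz' hzi
  · rw [hXc.cell, hYc.cell]
  · rw [hXc.meet, hYc.meet]

theorem eq_of_onLine (hX : Base X) (hP : ¬ OnLine P (X inf)) (hx : OnLine P (X x))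
    (hy : OnLine P (X y)) (h : x.dir = y.dir) : x = y := by
  by_contra hxy
  have hne {z : Label} (hz : OnLine P (X z)) : z ≠ inf := fun e => hP (e ▸ hz)
  exact hP (((hX.conc_inf_iff (hne hx) (hne hy)).2 h).onLine (hX.inj.ne hxy) hx hy)

theorem not_onLine_inf (hX : Base X) (hx : OnLine P (X x)) (hy : OnLine P (X y))
    (hxi : x ≠ inf) (hyi : y ≠ inf) (h : x.dir ≠ y.dir) : ¬ OnLine P (X inf) :=
  fun hP => hX.not_conc hxi hyi h ⟨P, hx, hy, hP⟩

end Base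

/-- The set of lines of an arrangement through a point. -/
def through {ι : Type*} (X : ι → ℙ ℂ V) (P : ℙ ℂ V) : Set ι := {x | OnLine P (X x)}

theorem Base.exists_onLine_of_three_le {X : Label → ℙ ℂ V} (hX : Base X) {P : ℙ ℂ V}
    (hP : ¬ OnLine P (X inf)) (h : 3 ≤ (through X P).encard) :
    (∃ i j k, OnLine P (X (col i)) ∧ OnLine P (X (row j)) ∧ OnLine P (X (obl k))) ∨
      ∃ (e : Fin 3 ⊕ Fin 3) (b : Fin 2), OnLine P (X (axis e)) ∧ OnLine P (X (obl b.castSucc)) ∧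
        OnLine P (X (obl 2)) := by
  obtain ⟨S, hS, hcard⟩ := Set.exists_subset_encard_eq h
  obtain ⟨x, y, z, hxy, hxz, hyz, rfl⟩ := Set.encard_eq_three.1 hcard
  have hx : OnLine P (X x) := hS (by simp)
  have hy : OnLine P (X y) := hS (by simp)
  have hz : OnLine P (X z) := hS (by simp)
  clear hS hcard
  revert hx hy hz hxy hxz hyz
  refine triple_induction Label.dir (P := fun x y z => x ≠ y → x ≠ z → y ≠ z → OnLine P (X x) →
    OnLine P (X y) → OnLine P (X z) → _) ?_ ?_ ?_ x y z
  · exact fun {x y z} h hyx hyz hxz hy hx hz => h hyx.symm hxz hyz hx hy hz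
  · exact fun {x y z} h hyz hyx hzx hy hz hx => h hyx.symm hzx.symm hyz hx hy hz
  intro x y z hxy hyz hxy' hxz' hyz' hx hy hz
  have hxy := hxy.lt_of_ne fun e => hxy' (hX.eq_of_onLine hP hx hy e)
  have hyz := hyz.lt_of_ne fun e => hyz' (hX.eq_of_onLine hP hy hz e)
  obtain ⟨i, j, k, rfl, rfl, rfl⟩ | ⟨e, b, rfl, rfl, rfl⟩ :=
    Label.cases_of_dir_lt hxy hyz fun e => hP (e ▸ hz)
  · exact Or.inl ⟨i, j, k, hx, hy, hz⟩
  · exact Or.inr ⟨e, b, hx, hy, hz⟩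

/-- The properties of an arrangement with two quadruple points on the line `inf` which are used to
determine its code: on each line there are three multiple points, and the points outside `inf` have
multiplicity at most three. -/
structure Frame (X : Label → ℙ ℂ V) : Prop extends Base X where
  triple : ∀ P, ¬ OnLine P (X inf) → (through X P).encard ≤ 3
  rich : ∀ x, 3 ≤ {P | OnLine P (X x) ∧ 3 ≤ (through X P).encard}.encard

namespace Frame

variable {X : Label → ℙ ℂ V} {P : ℙ ℂ V} {c : Code}

theorem onLine_iff (hX : Frame X) (hP : ¬ OnLine P (X inf)) {x y z : Label} (hx : OnLine P (X x))
    (hy : OnLine P (X y)) (hz : OnLine P (X z)) (hxy : x ≠ y) (hxz : x ≠ z) (hyz : y ≠ z)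
    (w : Label) : OnLine P (X w) ↔ w = x ∨ w = y ∨ w = z := by
  have hcard : ({x, y, z} : Set Label).encard = 3 :=
    Set.encard_eq_three.2 ⟨x, y, z, hxy, hxz, hyz, rfl⟩
  have hsub : {x, y, z} ⊆ through X P := by
    rintro _ (rfl | rfl | rfl) <;> assumption
  have heq := (Set.toFinite {x, y, z}).eq_of_subset_of_encard_le hsub
    (hcard ▸ hX.triple P hP)
  exact (Set.ext_iff.1 heq w).symm

theorem onLine_iff_of_grid (hX : Frame X) {i j k : Fin 3} (hi : OnLine P (X (col i)))
    (hj : OnLine P (X (row j))) (hk : OnLine P (X (obl k))) (w : Label) :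
    OnLine P (X w) ↔ w = col i ∨ w = row j ∨ w = obl k :=
  hX.onLine_iff (hX.not_onLine_inf hi hj (by simp) (by simp) (by simp [dir])) hi hj hk (by simp)
    (by simp) (by simp) w

theorem onLine_iff_of_meet (hX : Frame X) {e : Fin 3 ⊕ Fin 3} {b : Fin 2}
    (he : OnLine P (X (axis e))) (hb : OnLine P (X (obl b.castSucc))) (h2 : OnLine P (X (obl 2)))
    (w : Label) : OnLine P (X w) ↔ w = axis e ∨ w = obl b.castSucc ∨ w = obl 2 := by
  have hb2 : b.castSucc ≠ 2 := b.castSucc_ne_last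
  have hP := hX.not_onLine_inf hb h2 (by simp) (by simp) (by
    rw [Label.dir_obl_castSucc]
    decide)
  exact hX.onLine_iff hP he hb h2 (by cases e <;> simp) (by cases e <;> simp) (by simpa using hb2) w

theorem three_le_card (hX : Frame X) {x : Label} (Y : Finset Label) (hx : x ∉ Y)
    (h : ∀ P, OnLine P (X x) → 3 ≤ (through X P).encard → ∃ y ∈ Y, OnLine P (X y)) :
    3 ≤ Y.card := by
  have : Nonempty Label := ⟨inf⟩
  choose! f hfY hf using h
  have hle := Set.encard_le_encard_of_injOn (s := {P | OnLine P (X x) ∧ 3 ≤ (through X P).encard})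
    (t := Y) (f := f) (fun P hP => hfY P hP.1 hP.2) fun P hP Q hQ hPQ => by
      have hne : x ≠ f P := fun e => hx (e ▸ hfY P hP.1 hP.2)
      exact eq_of_onLine (hX.inj.ne hne) hP.1 (hf P hP.1 hP.2) hQ.1 (hPQ ▸ hf Q hQ.1 hQ.2)
  rw [Set.encard_coe_eq_coe_finsetCard] at hle
  exact_mod_cast (hX.rich x).trans hle

end Frame

theorem exists_option_iff {α : Type*} {p : α → Prop} (h : ∀ x y, p x → p y → x = y) :
    ∃ o : Option α, ∀ x, p x ↔ o = some x := by
  by_cases hp : ∃ x, p x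
  · obtain ⟨x, hx⟩ := hp
    exact ⟨some x, fun y => ⟨fun hy => congrArg some (h x y hx hy), by rintro ⟨⟩; exact hx⟩⟩
  · exact ⟨none, fun y => by simpa using fun hy => hp ⟨y, hy⟩⟩

section Admissible

variable {X : Label → ℙ ℂ V} {c : Code} {P : ℙ ℂ V}

theorem HasCode.inj (hc : HasCode X c) (hX : Base X) (k : Fin 3) : (c.cell k).Inj := by
  intro i i' hi hii'
  obtain ⟨j, hj⟩ := Option.ne_none_iff_exists'.1 hi
  obtain ⟨P, hPi, hPj, hPk⟩ := (hc.cell k i j).2 hj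
  have hPi' := ((hc.cell k i' j).2 (hii' ▸ hj)).rotate.onLine (hX.inj.ne (by simp)) hPj hPk
  have hP := hX.not_onLine_inf hPi hPj (by simp) (by simp) (by simp [dir])
  exact col.inj (hX.eq_of_onLine hP hPi hPi' rfl)

namespace Frame

theorem exists_hasCode (hX : Frame X) : ∃ c, HasCode X c := by
  have hcell (k i : Fin 3) : ∃ o : Option (Fin 3),
      ∀ j, Conc (X (col i)) (X (row j)) (X (obl k)) ↔ o = some j := by
    refine exists_option_iff ?_
    rintro j j' ⟨P, hi, hj, hk⟩ hc'
    have hj' := hc'.swap.rotate.onLine (hX.inj.ne (by simp)) hi hk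
    have hP := hX.not_onLine_inf hi hj (by simp) (by simp) (by simp [dir])
    exact row.inj (hX.eq_of_onLine hP hj hj' rfl)
  have hmeet (b : Fin 2) : ∃ o : Option (Fin 3 ⊕ Fin 3),
      ∀ e, Conc (X (axis e)) (X (obl b.castSucc)) (X (obl 2)) ↔ o = some e := by
    refine exists_option_iff ?_
    rintro e e' ⟨P, he, hb, h2⟩ hc'
    have hb2 : b.castSucc ≠ 2 := b.castSucc_ne_last
    have he' := hc'.rotate.onLine (hX.inj.ne (by simpa using hb2)) hb h2
    have := (hX.onLine_iff_of_meet he hb h2 _).1 he'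
    rcases e with i | j <;> rcases e' with i' | j'
    · exact Eq.symm (by simpa using this)
    · simp at this
    · simp at this
    · exact Eq.symm (by simpa using this)
  choose cell hcell using hcell
  choose meet hmeet using hmeet
  exact ⟨⟨cell, meet⟩, fun k i j => hcell k i j, hmeet⟩

theorem disj (hX : Frame X) (hc : HasCode X c) {k k' : Fin 3} (hk : k ≠ k') :
    (c.cell k).Disj (c.cell k') := by
  intro i hi hkk'
  obtain ⟨j, hj⟩ := Option.ne_none_iff_exists'.1 hi
  obtain ⟨P, hPi, hPj, hPk⟩ := (hc.cell k i j).2 hj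
  have hPk' := ((hc.cell k' i j).2 (hkk' ▸ hj)).onLine (hX.inj.ne (by simp)) hPi hPj
  simpa [hk.symm] using (hX.onLine_iff_of_grid hPi hPj hPk _).1 hPk'

theorem avoids (hX : Frame X) (hc : HasCode X c) {b : Fin 2} {k : Fin 3}
    (hk : k = b.castSucc ∨ k = 2) : (c.cell k).Avoids (c.meet b) := by
  intro i hi
  obtain ⟨j, hj⟩ := Option.ne_none_iff_exists'.1 hi
  obtain ⟨P, hPi, hPj, hPk⟩ := (hc.cell k i j).2 hj
  have key (e : Fin 3 ⊕ Fin 3) (he : OnLine P (X (axis e))) : c.meet b ≠ some e := by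
    intro hbe
    have hconc := (hc.meet b e).2 hbe
    have hne : axis e ≠ obl k := by rcases e with i | j <;> simp
    have hb2 : b.castSucc ≠ 2 := b.castSucc_ne_last
    have hiff := hX.onLine_iff_of_grid hPi hPj hPk
    obtain rfl | rfl := hk
    · simpa [hb2.symm] using (hiff _).1 (hconc.onLine (hX.inj.ne hne) he hPk)
    · simpa [hb2] using (hiff _).1 (hconc.rotate.rotate.swap.onLine (hX.inj.ne hne) he hPk)
  rw [hj]
  exact ⟨key (.inl i) hPi, key (.inr j) hPj⟩

theorem meet_inj (hX : Frame X) (hc : HasCode X c) (h : c.meet 0 ≠ none) :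
    c.meet 0 ≠ c.meet 1 := by
  intro h01
  obtain ⟨e, he⟩ := Option.ne_none_iff_exists'.1 h
  obtain ⟨P, hPe, hP0, hP2⟩ := (hc.meet 0 e).2 he
  have hne : axis e ≠ obl 2 := by rcases e with i | j <;> simp
  have hP1 := ((hc.meet 1 e).2 (h01 ▸ he)).rotate.rotate.swap.onLine (hX.inj.ne hne) hPe hP2
  rcases e with i | j <;> simpa using (hX.onLine_iff_of_meet hPe hP0 hP2 _).1 hP1

theorem multiple_point_cases (hX : Frame X) (hc : HasCode X c) (hP : ¬ OnLine P (X inf))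
    (h : 3 ≤ (through X P).encard) :
    (∃ i j k, c.cell k i = some j ∧ ∀ x, OnLine P (X x) ↔ x = col i ∨ x = row j ∨ x = obl k) ∨
      ∃ e b, c.meet b = some e ∧
        ∀ x, OnLine P (X x) ↔ x = axis e ∨ x = obl (Fin.castSucc b) ∨ x = obl 2 := by
  obtain ⟨i, j, k, hi, hj, hk⟩ | ⟨e, b, he, hb, h2⟩ := hX.exists_onLine_of_three_le hP h
  · exact Or.inl ⟨i, j, k, (hc.cell k i j).1 ⟨P, hi, hj, hk⟩, hX.onLine_iff_of_grid hi hj hk⟩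
  · exact Or.inr ⟨e, b, (hc.meet b e).1 ⟨P, he, hb, h2⟩, hX.onLine_iff_of_meet he hb h2⟩

theorem two_le_card (hX : Frame X) (hc : HasCode X c) {x : Label} (hx : x ≠ inf) (Y : Finset Label)
    (hxY : x ∉ Y) (hcell : ∀ i j k, c.cell k i = some j → (x = col i ∨ x = row j ∨ x = obl k) →
      ∃ y ∈ Y, y = col i ∨ y = row j ∨ y = obl k)
    (hmeet : ∀ e b, c.meet b = some e → (x = axis e ∨ x = obl (Fin.castSucc b) ∨ x = obl 2) →
      ∃ y ∈ Y, y = axis e ∨ y = obl (Fin.castSucc b) ∨ y = obl 2) : 2 ≤ Y.card := by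
  have h3 := hX.three_le_card (x := x) (insert inf Y) (by simp [hx, hxY]) fun P hPx hP => by
    by_cases hPi : OnLine P (X inf)
    · exact ⟨inf, by simp, hPi⟩
    obtain ⟨i, j, k, h, hiff⟩ | ⟨e, b, h, hiff⟩ := hX.multiple_point_cases hc hPi hP
    · obtain ⟨y, hy, hPy⟩ := hcell i j k h ((hiff x).1 hPx)
      exact ⟨y, by simp [hy], (hiff y).2 hPy⟩
    · obtain ⟨y, hy, hPy⟩ := hmeet e b h ((hiff x).1 hPx)
      exact ⟨y, by simp [hy], (hiff y).2 hPy⟩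
  have := Finset.card_insert_le inf Y
  omega

theorem rich_col (hX : Frame X) (hc : HasCode X c) (i : Fin 3) :
    2 ≤ Finset.card {k | c.cell k i ≠ none} + Finset.card {b | c.meet b = some (.inl i)} := by
  refine (hX.two_le_card hc (x := col i) (by simp)
    (({k | c.cell k i ≠ none} : Finset _).image obl ∪
      ({b | c.meet b = some (.inl i)} : Finset (Fin 2)).image (obl ∘ Fin.castSucc))
    (by simp) ?_ ?_).trans ((Finset.card_union_le _ _).trans
      (add_le_add Finset.card_image_le Finset.card_image_le))
  · rintro i' j k h hx
    obtain rfl : i = i' := by simpa using hx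
    exact ⟨obl k, by simp [h], by simp⟩
  · rintro (i' | j) b h hx
    · obtain rfl : i = i' := by simpa using hx
      exact ⟨obl b.castSucc, by simp [h], by simp⟩
    · simp at hx

theorem rich_row (hX : Frame X) (hc : HasCode X c) (j : Fin 3) :
    2 ≤ Finset.card {k | ∃ i, c.cell k i = some j} +
      Finset.card {b | c.meet b = some (.inr j)} := by
  refine (hX.two_le_card hc (x := row j) (by simp)
    (({k | ∃ i, c.cell k i = some j} : Finset _).image obl ∪
      ({b | c.meet b = some (.inr j)} : Finset (Fin 2)).image (obl ∘ Fin.castSucc))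
    (by simp) ?_ ?_).trans ((Finset.card_union_le _ _).trans
      (add_le_add Finset.card_image_le Finset.card_image_le))
  · rintro i j' k h hx
    obtain rfl : j = j' := by simpa using hx
    exact ⟨obl k, by simpa using Or.inl ⟨i, h⟩, by simp⟩
  · rintro (i | j') b h hx
    · simp at hx
    · obtain rfl : j = j' := by simpa using hx
      exact ⟨obl b.castSucc, by simp [h], by simp⟩

theorem rich_obl (hX : Frame X) (hc : HasCode X c) (b : Fin 2) :
    2 ≤ Finset.card {i | c.cell b.castSucc i ≠ none} + if c.meet b = none then 0 else 1 := by
  have hb2 : b.castSucc ≠ 2 := b.castSucc_ne_last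
  have hcard : (if c.meet b = none then 0 else 1) =
      (if c.meet b = none then ∅ else {obl 2} : Finset Label).card := by split_ifs <;> rfl
  rw [hcard]
  refine (hX.two_le_card hc (x := obl b.castSucc) (by simp)
    (({i | c.cell b.castSucc i ≠ none} : Finset _).image col ∪
      if c.meet b = none then ∅ else {obl 2}) ?_ ?_ ?_).trans ((Finset.card_union_le _ _).trans
      (add_le_add_left Finset.card_image_le _))
  · split_ifs <;> simp [hb2]
  · rintro i j k h hx
    obtain rfl : b.castSucc = k := by simpa using hx
    exact ⟨col i, by simp [h], by simp⟩
  · rintro e b' h hx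
    obtain rfl : b = b' := by rcases e with i | j <;> simpa [hb2] using hx
    exact ⟨obl 2, by simp [h], by simp⟩

theorem rich_obl_two (hX : Frame X) (hc : HasCode X c) :
    3 ≤ Finset.card {i | c.cell 2 i ≠ none} + Finset.card {b | c.meet b ≠ none} := by
  refine (hX.three_le_card (x := obl 2)
    (({i | c.cell 2 i ≠ none} : Finset _).image col ∪
      ({b | c.meet b ≠ none} : Finset (Fin 2)).image (obl ∘ Fin.castSucc)) ?_ ?_).trans
    ((Finset.card_union_le _ _).trans (add_le_add Finset.card_image_le Finset.card_image_le))
  · simp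
  intro P hP2 hP
  by_cases hPi : OnLine P (X inf)
  · have hsub : through X P ⊆ {inf, obl 2} := by
      intro x hx
      by_contra hx'
      obtain ⟨hxi, hx2⟩ : x ≠ inf ∧ x ≠ obl 2 := by simpa using hx'
      have hdir : ∀ x, x ≠ inf → x ≠ obl 2 → x.dir ≠ (obl 2).dir := by decide
      exact hX.not_conc hxi (by simp) (hdir x hxi hx2) ⟨P, hx, hP2, hPi⟩
    have h2 := (Set.encard_le_encard hsub).trans (Set.encard_pair (by simp)).le
    exact absurd (hP.trans h2) (by decide)
  obtain ⟨i, j, k, h, hiff⟩ | ⟨e, b, h, hiff⟩ := hX.multiple_point_cases hc hPi hP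
  · obtain rfl : 2 = k := by simpa using (hiff _).1 hP2
    exact ⟨col i, by simp [h], (hiff _).2 (by simp)⟩
  · exact ⟨obl b.castSucc, by simp [h], (hiff _).2 (by simp)⟩

theorem admissible (hX : Frame X) (hc : HasCode X c) : c.Admissible where
  inj := hc.inj hX.toBase
  disj _ _ := hX.disj hc
  avoids _ := ⟨hX.avoids hc (Or.inl rfl), hX.avoids hc (Or.inr rfl)⟩
  meet_inj := hX.meet_inj hc
  rich := ⟨hX.rich_col hc, hX.rich_row hc, hX.rich_obl hc, hX.rich_obl_two hc⟩

end Frame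

end Admissible

/-! ### Relabelling -/

namespace Label

/-- Exchange of columns and rows. -/
def transpose : Equiv.Perm Label :=
  Function.Involutive.toPerm
    (fun | col i => row i | row j => col j | inf => inf | obl k => obl k)
    (by rintro (i | j | _ | k) <;> rfl)

/-- Permutation of the columns by `s` and of the rows by `t`, and exchange of `obl 0` and `obl 1` if
`sw` is true. -/
def permute (sw : Bool) (s t : Equiv.Perm (Fin 3)) : Equiv.Perm Label where
  toFun
    | col i => col (s i)
    | row j => row (t j)
    | inf => inf
    | obl k => obl (Code.exchange sw k)
  invFun
    | col i => col (s.symm i)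
    | row j => row (t.symm j)
    | inf => inf
    | obl k => obl ((Code.exchange sw).symm k)
  left_inv := by rintro (i | j | _ | k) <;> simp
  right_inv := by rintro (i | j | _ | k) <;> simp

theorem dir_transpose_eq_iff : ∀ x y : Label,
    (transpose x).dir = (transpose y).dir ↔ x.dir = y.dir := by
  decide

theorem dir_permute (sw : Bool) (s t : Equiv.Perm (Fin 3)) (x : Label) :
    (permute sw s t x).dir = x.dir := by
  rcases x with i | j | _ | k
  · rfl
  · rfl
  · rfl
  · change (obl (Code.exchange sw k)).dir = (obl k).dir
    decide +revert

end Label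

theorem Code.exchange_castSucc : ∀ (sw : Bool) (b : Fin 2),
    Code.exchange sw b.castSucc = (Code.exchange sw b).castSucc := by
  decide

section Permutations

variable {X : Label → ℙ ℂ V} {c : Code}

theorem Frame.comp (hX : Frame X) (σ : Equiv.Perm Label) (hinf : σ inf = inf)
    (hdir : ∀ x y, (σ x).dir = (σ y).dir ↔ x.dir = y.dir) : Frame (X ∘ σ) := by
  have hthrough (P : ℙ ℂ V) : (through (X ∘ σ) P).encard = (through X P).encard :=
    Set.encard_preimage_of_bijective σ.bijective (through X P)
  have hne {x : Label} (hx : x ≠ inf) : σ x ≠ inf := fun h => hx (σ.injective (h.trans hinf.symm))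
  refine ⟨⟨hX.inj.comp σ.injective, fun {x y} hx hy => ?_⟩, fun P hP => ?_, fun x => ?_⟩
  · rw [← hdir, ← hX.conc_inf_iff (hne hx) (hne hy)]
    simp only [Function.comp_apply, hinf]
  · rw [hthrough]
    exact hX.triple P (by simpa only [Function.comp_apply, hinf] using hP)
  · simp only [hthrough]
    exact hX.rich (σ x)

theorem Frame.comp_transpose (hX : Frame X) : Frame (X ∘ transpose) :=
  hX.comp transpose rfl dir_transpose_eq_iff

theorem Frame.comp_permute (hX : Frame X) (sw : Bool) (s t : Equiv.Perm (Fin 3)) :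
    Frame (X ∘ permute sw s t) :=
  hX.comp _ rfl fun x y => by rw [dir_permute, dir_permute]

theorem HasCode.transpose (hc : HasCode X c) (hinj : ∀ k, (c.cell k).Inj) :
    HasCode (X ∘ Label.transpose) c.transpose where
  cell k i j := by
    refine (conc_swap.trans (hc.cell k j i)).trans ?_
    simp only [Code.transpose, Fin.find?_eq_some_iff, decide_eq_true_eq]
    refine ⟨fun h => ⟨h, fun j' hj' => decide_eq_false fun h' => hj'.ne ?_⟩, And.left⟩
    exact hinj k j' j (h' ▸ Option.some_ne_none i) (h'.trans h.symm)
  meet b e := by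
    have haxis : Label.transpose (axis e) = axis e.swap := by cases e <;> rfl
    simp only [Function.comp_apply, haxis]
    refine (hc.meet b e.swap).trans ?_
    rw [Code.transpose, Option.map_eq_some_iff]
    exact ⟨fun h => ⟨_, h, Sum.swap_swap e⟩, by rintro ⟨e, h, rfl⟩; rwa [Sum.swap_swap]⟩

theorem HasCode.permute (hc : HasCode X c) (sw : Bool) (s t : Equiv.Perm (Fin 3)) :
    HasCode (X ∘ Label.permute sw s t) (c.permute sw s t) where
  cell k i j := by
    refine (hc.cell _ (s i) (t j)).trans ?_
    simp [Code.permute, Equiv.symm_apply_eq]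
  meet b e := by
    have haxis : Label.permute sw s t (axis e) = axis (Sum.map s t e) := by cases e <;> rfl
    have hobl : Label.permute sw s t (obl b.castSucc) = obl (Code.exchange sw b).castSucc :=
      congrArg obl (Code.exchange_castSucc sw b)
    have hobl₂ : Label.permute sw s t (obl 2) = obl 2 := by cases sw <;> rfl
    simp only [Function.comp_apply, haxis, hobl, hobl₂]
    rw [hc.meet, Code.permute, Option.map_eq_some_iff]
    refine ⟨fun h => ⟨_, h, by cases e <;> simp⟩, ?_⟩
    rintro ⟨e, h, rfl⟩
    rw [h]
    cases e <;> simp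

theorem Frame.exists_comp_hasCode (hX : Frame X) :
    ∃ σ : Equiv.Perm Label, Frame (X ∘ σ) ∧ ∃ c ∈ Code.all, HasCode (X ∘ σ) c := by
  obtain ⟨c, hc⟩ := hX.exists_hasCode
  have hadm := hX.admissible hc
  have hne : ∃ i, c.cell 2 i ≠ none := by
    by_contra! h
    have h0 : Finset.card {i | c.cell 2 i ≠ none} = 0 := by simp [h]
    have h2 : Finset.card {b | c.meet b ≠ none} ≤ 2 := Finset.card_le_univ _
    have h3 := hadm.rich.obl_two
    omega
  obtain ⟨s, t, hst⟩ := (hadm.inj 2).exists_perm_mem_normal hne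
  have hX' := hX.comp_permute false s t
  have hc' := hc.permute false s t
  have hadm' := hX'.admissible hc'
  obtain ⟨sw, s', t', h | h⟩ := hadm'.exists_permute_mem_all hst
  · exact ⟨permute false s t * permute sw s' t', hX'.comp_permute sw s' t', _, h,
      hc'.permute sw s' t'⟩
  · exact ⟨permute false s t * transpose * permute sw s' t',
      hX'.comp_transpose.comp_permute sw s' t', _, h,
      (hc'.transpose hadm'.inj).permute sw s' t'⟩

end Permutations

/-! ### Labelling the lines -/

theorem exists_equiv_comp_eq {α β : Type} {γ : Type*} [Finite α] [Finite β] [Finite γ]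
    (f : α → γ) (g : β → γ) (hcard : Nat.card α = Nat.card β) (c₀ : γ)
    (h : ∀ c ≠ c₀, Nat.card {a // f a = c} = Nat.card {b // g b = c}) :
    ∃ e : α ≃ β, g ∘ e = f := by
  classical
  cases nonempty_fintype γ
  have hsum {δ : Type} [Finite δ] (f : δ → γ) : Nat.card δ =
      ∑ c ∈ Finset.univ.erase c₀, Nat.card {a // f a = c} + Nat.card {a // f a = c₀} := by
    rw [Finset.sum_erase_add _ _ (Finset.mem_univ c₀), ← Nat.card_sigma]
    exact Nat.card_congr (Equiv.sigmaFiberEquiv f).symm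
  have hfiber (c : γ) : Nat.card {a // f a = c} = Nat.card {b // g b = c} := by
    obtain rfl | hc := eq_or_ne c c₀
    · have hfg := Finset.sum_congr (s₁ := Finset.univ.erase c) rfl fun c' hc' =>
        h c' (Finset.ne_of_mem_erase hc')
      have hf := hsum f
      have hg := hsum g
      omega
    · exact h c hc
  have e (c : γ) : {a // f a = c} ≃ {b // g b = c} := (Finite.card_eq.1 (hfiber c)).some
  exact ⟨Equiv.ofFiberEquiv e, funext fun a => Equiv.ofFiberEquiv_map e a⟩

theorem exists_direction {ι : Type*} {X : ι → ℙ ℂ V} (hX : Function.Injective X) {i₀ : ι}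
    {T : Fin 3 → ℙ ℂ V} (hT : Function.Injective T) (hTi : ∀ d, OnLine (T d) (X i₀)) :
    ∃ f : ι → Fin 5, (∀ x, f x = 4 ↔ x = i₀) ∧
      ∀ x d, f x = d.castAdd 2 ↔ x ≠ i₀ ∧ OnLine (T d) (X x) := by
  have h3 : ∀ d : Fin 3, d.castAdd 2 ≠ 3 := by decide
  have h4 : ∀ d : Fin 3, d.castAdd 2 ≠ 4 := by decide
  have h (x : ι) : ∃ c : Fin 5, (c = 4 ↔ x = i₀) ∧
      ∀ d : Fin 3, c = d.castAdd 2 ↔ x ≠ i₀ ∧ OnLine (T d) (X x) := by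
    by_cases hx : x = i₀
    · exact ⟨4, by simp [hx], fun d => by simpa [hx] using (h4 d).symm⟩
    by_cases hd : ∃ d, OnLine (T d) (X x)
    · obtain ⟨d, hd⟩ := hd
      refine ⟨d.castAdd 2, by simp [hx, h4], fun d' => ?_⟩
      rw [(Fin.castAdd_injective 3 2).eq_iff]
      exact ⟨by rintro rfl; exact ⟨hx, hd⟩,
        fun h => hT (eq_of_onLine (hX.ne hx) hd (hTi d) h.2 (hTi d'))⟩
    · push Not at hd
      exact ⟨3, by simp [hx], fun d => by simpa [hd] using (h3 d).symm⟩
  choose f hf using h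
  exact ⟨f, fun x => (hf x).1, fun x => (hf x).2⟩

theorem exists_equiv_dir_eq_iff {A : Lines 10} (hA : Function.Injective A) {i₀ : Fin 10}
    {T : Fin 3 → ℙ ℂ V} (hT : Function.Injective T) (hTi : ∀ d, OnLine (T d) (A i₀))
    (h0 : mult A (T 0) = 4) (h1 : mult A (T 1) = 4) (h2 : mult A (T 2) = 3) :
    ∃ e : Label ≃ Fin 10, e inf = i₀ ∧
      ∀ x ≠ inf, ∀ d : Fin 3, x.dir = d.castAdd 2 ↔ OnLine (T d) (A (e x)) := by
  obtain ⟨f, hf4, hf⟩ := exists_direction hA hT hTi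
  have hcard4 : Nat.card {x // f x = 4} = 1 := by simp only [hf4, Nat.card_unique]
  have hcard (d : Fin 3) {n : ℕ} (h : mult A (T d) = (n + 1 : ℕ)) :
      Nat.card {x // f x = d.castAdd 2} = n := by
    have hset : {x | f x = d.castAdd 2} = {x | OnLine (T d) (A x)} \ {i₀} := by
      ext x
      exact (hf x d).trans and_comm
    rw [mult] at h
    rw [← Set.coe_ofPred, Nat.card_coe_set_eq, hset, Set.ncard_sdiff_singleton_of_mem (hTi d),
      Set.ncard_def, h]
    rfl
  obtain ⟨e, he⟩ := exists_equiv_comp_eq dir f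
    (by rw [Nat.card_eq_fintype_card, Nat.card_eq_fintype_card]; rfl) 3 fun c hc => by
      rw [Nat.card_eq_fintype_card]
      fin_cases c
      · exact (by decide : Fintype.card {x : Label // x.dir = 0} = 3).trans (hcard 0 h0).symm
      · exact (by decide : Fintype.card {x : Label // x.dir = 1} = 3).trans (hcard 1 h1).symm
      · exact (by decide : Fintype.card {x : Label // x.dir = 2} = 2).trans (hcard 2 h2).symm
      · exact absurd rfl hc
      · exact (by decide : Fintype.card {x : Label // x.dir = 4} = 1).trans hcard4.symm
  have hdir (x : Label) : f (e x) = x.dir := congrFun he x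
  have heinf {x : Label} : e x = i₀ ↔ x = inf := by
    rw [← hf4, hdir]
    decide +revert
  exact ⟨e, heinf.2 rfl, fun x hx d => by rw [← hdir, hf, and_iff_right (heinf.not.2 hx)]⟩

theorem base_of_dir_eq_iff {X : Label → ℙ ℂ V} (hX : Function.Injective X) {T : Fin 3 → ℙ ℂ V}
    (hTi : ∀ d, OnLine (T d) (X inf))
    (hT : ∀ x ≠ inf, ∀ d : Fin 3, x.dir = d.castAdd 2 ↔ OnLine (T d) (X x)) : Base X := by
  refine ⟨hX, fun {x y} hx hy => ⟨?_, fun hxy => ?_⟩⟩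
  · rintro ⟨S, hSx, hSy, hSi⟩
    have hS {x : Label} (hx : x ≠ inf) (hSx : OnLine S (X x)) (d : Fin 3) :
        x.dir = d.castAdd 2 ↔ S = T d :=
      (hT x hx d).trans
        ⟨fun h => eq_of_onLine (hX.ne hx) hSx hSi h (hTi d), fun h => h ▸ hSx⟩
    exact (by decide : ∀ c c' : Fin 5, c ≠ 4 → c' ≠ 4 →
      (∀ d : Fin 3, c = d.castAdd 2 ↔ c' = d.castAdd 2) → c = c') _ _ (mt Label.eq_inf_of_dir_eq hx)
      (mt Label.eq_inf_of_dir_eq hy) fun d => (hS hx hSx d).trans (hS hy hSy d).symm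
  · obtain rfl | ⟨d, hd⟩ := (by decide : ∀ x y : Label, x ≠ inf → x.dir = y.dir → x = y ∨
      ∃ d : Fin 3, x.dir = d.castAdd 2) x y hx hxy
    · simp only [conc_self]
    · exact ⟨T d, (hT x hx d).1 hd, (hT y hy d).1 (hxy ▸ hd), hTi d⟩

theorem mult_le_three {n : ℕ} {A : Lines n} (h5 : ∀ r : ℕ, 5 ≤ r → numPoints A r = 0)
    {P : ℙ ℂ V} (hP : mult A P ≠ 4) : mult A P ≤ 3 := by
  obtain ⟨r, hr⟩ := ENat.ne_top_iff_exists.1 (Set.toFinite {i | OnLine P (A i)}).encard_lt_top.ne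
  change (r : ℕ∞) = mult A P at hr
  rw [← hr] at hP ⊢
  have h4 : r ≠ 4 := by exact_mod_cast hP
  have hr5 : ¬ 5 ≤ r := fun h => by
    have hempty := h5 r h
    rw [numPoints, Set.encard_eq_zero] at hempty
    exact Set.eq_empty_iff_forall_notMem.1 hempty P hr.symm
  have h3 : r ≤ 3 := by omega
  exact_mod_cast h3

theorem exists_equiv_frame {A : Lines 10} (hA : Function.Injective A) (hNR : NonReductive A)
    (h4 : numPoints A 4 = 2) (h5 : ∀ r : ℕ, 5 ≤ r → numPoints A r = 0)
    (hline : ∃ i, ∀ P, mult A P = 4 → OnLine P (A i)) :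
    ∃ e : Label ≃ Fin 10, Frame (A ∘ e) := by
  obtain ⟨i₀, hi₀⟩ := hline
  obtain ⟨P, Q, hPQ, hquad⟩ := Set.encard_eq_two.1 h4
  have hP : mult A P = 4 := hquad.symm.subset (Or.inl rfl)
  have hQ : mult A Q = 4 := hquad.symm.subset (Or.inr rfl)
  obtain ⟨R, ⟨hRi, hR⟩, hRPQ⟩ := Set.not_subset.1 fun hsub =>
    absurd ((hNR i₀).trans ((Set.encard_le_encard hsub).trans (Set.encard_pair hPQ).le)) (by decide)
  have hR3 := (mult_le_three h5 fun h => hRPQ (hquad.subset h)).antisymm hR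
  obtain ⟨hRP, hRQ⟩ : R ≠ P ∧ R ≠ Q := by simpa using hRPQ
  have hT : Function.Injective ![P, Q, R] := by
    simp [Function.Injective, Fin.forall_fin_succ, hPQ, hPQ.symm, hRP, hRP.symm, hRQ, hRQ.symm]
  have hTi : ∀ d, OnLine (![P, Q, R] d) (A i₀) :=
    Fin.forall_fin_succ.2 ⟨hi₀ P hP, Fin.forall_fin_two.2 ⟨hi₀ Q hQ, hRi⟩⟩
  obtain ⟨e, rfl, he⟩ := exists_equiv_dir_eq_iff hA hT hTi hP hQ hR3
  have hthrough (P : ℙ ℂ V) : (through (A ∘ e) P).encard = mult A P :=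
    Set.encard_preimage_of_bijective e.bijective ({i | OnLine P (A i)})
  refine ⟨e, base_of_dir_eq_iff (hA.comp e.injective) hTi he, fun P hP => ?_, fun x => ?_⟩
  · rw [hthrough]
    exact mult_le_three h5 fun h => hP (hi₀ P h)
  · simp only [hthrough]
    exact hNR (e x)

/-! ### Solving the equations given by a code -/

namespace Param

/-- The equations expressing that the arrangement with the given parameters has the code `c`. -/
structure Realizes (q : Param) (c : Code) : Prop where
  cell : ∀ k i j, q.b j = q.slope k * q.a i + q.icept k ↔ c.cell k i = some j
  col : ∀ (b : Fin 2) i, q.slope b.castSucc * q.a i + q.icept b.castSucc = q.μ * q.a i + q.ν ↔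
    c.meet b = some (.inl i)
  row : ∀ (b : Fin 2) j, q.μ * (q.b j - q.icept b.castSucc) = q.slope b.castSucc * (q.b j - q.ν) ↔
    c.meet b = some (.inr j)

variable {q : Param} {c : Code}

theorem conc_cell_iff (i j k : Fin 3) :
    Conc (q.lines (col i)) (q.lines (row j)) (q.lines (obl k)) ↔
      q.b j = q.slope k * q.a i + q.icept k := by
  rw [conc_iff, Matrix.det_fin_three]
  simp only [coef, Matrix.of_apply, Matrix.cons_val]
  grind

theorem conc_col_iff (i k l : Fin 3) :
    Conc (q.lines (col i)) (q.lines (obl k)) (q.lines (obl l)) ↔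
      q.slope k * q.a i + q.icept k = q.slope l * q.a i + q.icept l := by
  rw [conc_iff, Matrix.det_fin_three]
  simp only [coef, Matrix.of_apply, Matrix.cons_val]
  grind

theorem conc_row_iff (j k l : Fin 3) :
    Conc (q.lines (row j)) (q.lines (obl k)) (q.lines (obl l)) ↔
      q.slope l * (q.b j - q.icept k) = q.slope k * (q.b j - q.icept l) := by
  rw [conc_iff, Matrix.det_fin_three]
  simp only [coef, Matrix.of_apply, Matrix.cons_val]
  grind

theorem hasCode_lines_iff : HasCode q.lines c ↔ q.Realizes c := by
  constructor
  · intro h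
    exact ⟨fun k i j => (conc_cell_iff i j k).symm.trans (h.cell k i j),
      fun b i => (conc_col_iff i b.castSucc 2).symm.trans (h.meet b (.inl i)),
      fun b j => (conc_row_iff j b.castSucc 2).symm.trans (h.meet b (.inr j))⟩
  · intro h
    refine ⟨fun k i j => (conc_cell_iff i j k).trans (h.cell k i j), fun b x => ?_⟩
    rcases x with i | j
    · exact (conc_col_iff i b.castSucc 2).trans (h.col b i)
    · exact (conc_row_iff j b.castSucc 2).trans (h.row b j)

end Param

theorem mem_par₁_iff {t : ℂ} : t ∈ par₁ ↔ t ^ 2 = t + 1 := by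
  have h5 : ((√5 : ℝ) : ℂ) ^ 2 = 5 := mod_cast Real.sq_sqrt (by norm_num : (0 : ℝ) ≤ 5)
  have hfactor : t ^ 2 - (t + 1) = (t - (1 + (√5 : ℝ)) / 2) * (t - (1 - (√5 : ℝ)) / 2) := by
    linear_combination h5 / 4
  rw [← sub_eq_zero, hfactor, mul_eq_zero, sub_eq_zero, sub_eq_zero]
  rfl

theorem mem_par₃_iff {t : ℂ} : t ∈ par₃ ↔ t ^ 2 + t = 1 := by
  have h5 : ((√5 : ℝ) : ℂ) ^ 2 = 5 := mod_cast Real.sq_sqrt (by norm_num : (0 : ℝ) ≤ 5)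
  have hfactor : t ^ 2 + t - 1 = (t - (-1 + (√5 : ℝ)) / 2) * (t - (-1 - (√5 : ℝ)) / 2) := by
    linear_combination h5 / 4
  rw [← sub_eq_zero, hfactor, mul_eq_zero, sub_eq_zero, sub_eq_zero]
  rfl

theorem mem_par₄_iff {t : ℂ} : t ∈ par₄ ↔ t ^ 2 = 2 := by
  have h2 : ((√2 : ℝ) : ℂ) ^ 2 = 2 := mod_cast Real.sq_sqrt (by norm_num : (0 : ℝ) ≤ 2)
  have hfactor : t ^ 2 - 2 = (t - (√2 : ℝ)) * (t - -(√2 : ℝ)) := by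
    linear_combination h2
  rw [← sub_eq_zero, hfactor, mul_eq_zero, sub_eq_zero, sub_eq_zero]
  rfl

/-- The parameters of the members of the first family. -/
def param₁ (t : ℂ) : Param := ⟨t, 1 - t, 1, 1 - t, -t, 2 - t, 0⟩

/-- The parameters of the members of the second family. -/
def param₂ (t : ℂ × ℂ) : Param := ⟨t.1, t.2, t.2 - 1, 1, 1 - t.1, 1, 0⟩

/-- The parameters of the members of the third family. -/
def param₃ (t : ℂ) : Param := ⟨t ^ 2, t, -(1 / t), t, 1 / t, 1, 0⟩

/-- The parameters of the members of the fourth family. -/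
def param₄ (s : ℂ) : Param := ⟨1 + s / 2, 2 + s, s, -s, 1, 1, 0⟩

/-- The parameters of the arrangements with code `codeCurve`. -/
def paramCurve (s : ℂ) : Param := ⟨s, s, -1, 1, s, 1, 0⟩

/-- The parameters of the arrangement with code `codePoint`. -/
def paramPoint : Param := ⟨2 / 3, 1 / 3, -1, 1, 2 / 3, 1, 0⟩

/-- The parameters of the arrangements with code `codePair₁`, where `u ^ 2 = -1`. -/
def paramPair₁ (u : ℂ) : Param := ⟨u, 1 + u, u, 1, 2, 1, 0⟩

/-- The parameters of the arrangements with code `codePair₂`, where `u ^ 2 = -1`. -/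
def paramPair₂ (u : ℂ) : Param := ⟨1 - u, 1 - u, u, 1 - u, -u, 1 + u, 0⟩

/-- The values of `s` for which `paramCurve s` has the code `codeCurve`. -/
def curveParams : Set ℂ := {0, 1, 2, 1 / 2}ᶜ

namespace Param

open Code

variable {q : Param} {c : Code}

theorem Realizes.eq_diagonal (h : q.Realizes c) (h0 : c.cell 2 0 = some 0)
    (h1 : c.cell 2 1 = some 1) : q.μ = 1 ∧ q.ν = 0 := by
  have e0 : 0 = q.μ * 0 + q.ν := (h.cell 2 0 0).2 h0
  have e1 : 1 = q.μ * 1 + q.ν := (h.cell 2 1 1).2 h1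
  grind

theorem Realizes.eq_param₁ (h : q.Realizes code₁) : ∃ t ∈ par₁, q = param₁ t := by
  have e₁ : q.t = q.κ * 0 + q.γ₀ := (h.cell 0 0 2).2 rfl
  have e₂ : 1 = q.κ * q.s + q.γ₀ := (h.cell 0 2 1).2 rfl
  have e₃ : q.t = q.κ * 1 + q.γ₁ := (h.cell 1 1 2).2 rfl
  have e₄ : 0 = q.κ * q.s + q.γ₁ := (h.cell 1 2 0).2 rfl
  have e₅ : 0 = q.μ * 0 + q.ν := (h.cell 2 0 0).2 rfl
  have e₆ : q.κ * 1 + q.γ₀ = q.μ * 1 + q.ν := (h.col 0 1).2 rfl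
  have e₇ : q.μ * (1 - q.γ₁) = q.κ * (1 - q.ν) := (h.row 1 1).2 rfl
  have hκ : q.κ = 1 := by linear_combination e₁ + e₄ - e₂ - e₃
  refine ⟨q.s, mem_par₁_iff.2 (by grind), ?_⟩
  ext <;> grind [param₁]

theorem Realizes.eq_param₂ (h : q.Realizes code₂) : ∃ t ∈ par₂, q = param₂ t := by
  obtain ⟨hμ, hν⟩ := h.eq_diagonal rfl rfl
  have e₁ : 1 = q.κ * 0 + q.γ₀ := (h.cell 0 0 1).2 rfl
  have e₂ : q.t = q.κ * 1 + q.γ₀ := (h.cell 0 1 2).2 rfl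
  have e₃ : 0 = q.κ * q.s + q.γ₁ := (h.cell 1 2 0).2 rfl
  have e₄ : q.κ * q.s + q.γ₀ = q.μ * q.s + q.ν := (h.col 0 2).2 rfl
  have e₅ : q.μ * (q.t - q.γ₁) = q.κ * (q.t - q.ν) := (h.row 1 2).2 rfl
  have hs : q.s = (q.t - 1) ^ 2 := by grind
  refine ⟨(q.s, q.t), ⟨hs, by grind⟩, ?_⟩
  ext <;> grind [param₂]

theorem Realizes.eq_param₃ (hq : q.Good) (h : q.Realizes code₃) : ∃ t ∈ par₃, q = param₃ t := by
  obtain ⟨hμ, hν⟩ := h.eq_diagonal rfl rfl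
  have e₁ : q.t = q.κ * 0 + q.γ₀ := (h.cell 0 0 2).2 rfl
  have e₂ : 0 = q.κ * q.s + q.γ₀ := (h.cell 0 2 0).2 rfl
  have e₃ : 0 = q.κ * 1 + q.γ₁ := (h.cell 1 1 0).2 rfl
  have e₄ : 1 = q.κ * q.s + q.γ₁ := (h.cell 1 2 1).2 rfl
  have e₅ : q.μ * (q.t - q.γ₁) = q.κ * (q.t - q.ν) := (h.row 1 2).2 rfl
  refine ⟨q.t, mem_par₃_iff.2 (by grind), ?_⟩
  ext <;> grind [param₃, hq.t0]

theorem Realizes.eq_param₄ (h : q.Realizes code₄) : ∃ t ∈ par₄, q = param₄ t := by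
  obtain ⟨hμ, hν⟩ := h.eq_diagonal rfl rfl
  have e₁ : 0 = q.κ * 1 + q.γ₀ := (h.cell 0 1 0).2 rfl
  have e₂ : 1 = q.κ * q.s + q.γ₀ := (h.cell 0 2 1).2 rfl
  have e₃ : 1 = q.κ * 0 + q.γ₁ := (h.cell 1 0 1).2 rfl
  have e₄ : q.t = q.κ * q.s + q.γ₁ := (h.cell 1 2 2).2 rfl
  have e₅ : q.μ * (q.t - q.γ₀) = q.κ * (q.t - q.ν) := (h.row 0 2).2 rfl
  refine ⟨q.κ, mem_par₄_iff.2 (by grind), ?_⟩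
  ext <;> grind [param₄]

theorem Realizes.eq_paramCurve (hq : q.Good) (h : q.Realizes codeCurve) :
    ∃ s ∈ curveParams, q = paramCurve s := by
  obtain ⟨hμ, hν⟩ := h.eq_diagonal rfl rfl
  have e₁ : 1 = q.κ * 0 + q.γ₀ := (h.cell 0 0 1).2 rfl
  have e₂ : 0 = q.κ * 1 + q.γ₀ := (h.cell 0 1 0).2 rfl
  have e₃ : q.t = q.κ * 0 + q.γ₁ := (h.cell 1 0 2).2 rfl
  have e₄ : q.t = q.μ * q.s + q.ν := (h.cell 2 2 2).2 rfl
  have n₁ : ¬ 1 = q.κ * 1 + q.γ₁ := (h.cell 1 1 1).not.2 (by decide)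
  have n₂ : ¬ q.t = q.κ * q.s + q.γ₀ := (h.cell 0 2 2).not.2 (by decide)
  refine ⟨q.s, ?_, ?_⟩
  · simp only [curveParams, Set.mem_compl_iff, Set.mem_insert_iff, Set.mem_singleton_iff]
    grind [hq.s0, hq.s1]
  · ext <;> grind [paramCurve]

theorem Realizes.eq_paramPoint (h : q.Realizes codePoint) : q = paramPoint := by
  obtain ⟨hμ, hν⟩ := h.eq_diagonal rfl rfl
  have e₁ : 1 = q.κ * 0 + q.γ₀ := (h.cell 0 0 1).2 rfl
  have e₂ : 0 = q.κ * 1 + q.γ₀ := (h.cell 0 1 0).2 rfl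
  have e₃ : q.t = q.κ * q.s + q.γ₀ := (h.cell 0 2 2).2 rfl
  have e₄ : 0 = q.κ * q.s + q.γ₁ := (h.cell 1 2 0).2 rfl
  have e₅ : q.μ * (q.t - q.γ₁) = q.κ * (q.t - q.ν) := (h.row 1 2).2 rfl
  ext <;> grind [paramPoint]

theorem Realizes.eq_paramPair₁ (h : q.Realizes codePair₁) :
    ∃ u, u ^ 2 = -1 ∧ q = paramPair₁ u := by
  obtain ⟨hμ, hν⟩ := h.eq_diagonal rfl rfl
  have e₁ : 1 = q.κ * 0 + q.γ₀ := (h.cell 0 0 1).2 rfl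
  have e₂ : q.t = q.κ * 1 + q.γ₀ := (h.cell 0 1 2).2 rfl
  have e₃ : 0 = q.κ * q.s + q.γ₀ := (h.cell 0 2 0).2 rfl
  have e₄ : 1 = q.κ * q.s + q.γ₁ := (h.cell 1 2 1).2 rfl
  have e₅ : q.μ * (q.t - q.γ₁) = q.κ * (q.t - q.ν) := (h.row 1 2).2 rfl
  have hκ : q.κ ^ 2 = -1 := by grind
  refine ⟨q.κ, hκ, ?_⟩
  ext <;> grind [paramPair₁]

theorem Realizes.eq_paramPair₂ (hq : q.Good) (h : q.Realizes codePair₂) :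
    ∃ u, u ^ 2 = -1 ∧ q = paramPair₂ u := by
  have e₁ : q.t = q.κ * 0 + q.γ₀ := (h.cell 0 0 2).2 rfl
  have e₂ : 1 = q.κ * 1 + q.γ₀ := (h.cell 0 1 1).2 rfl
  have e₃ : 0 = q.κ * 1 + q.γ₁ := (h.cell 1 1 0).2 rfl
  have e₄ : 1 = q.κ * q.s + q.γ₁ := (h.cell 1 2 1).2 rfl
  have e₅ : 0 = q.μ * 0 + q.ν := (h.cell 2 0 0).2 rfl
  have e₆ : q.κ * q.s + q.γ₀ = q.μ * q.s + q.ν := (h.col 0 2).2 rfl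
  have e₇ : q.μ * (q.t - q.γ₁) = q.κ * (q.t - q.ν) := (h.row 1 2).2 rfl
  have hκ : q.κ ^ 2 = -1 := by grind [hq.s0, hq.κμ, hq.κ0, hq.t0]
  refine ⟨q.κ, hκ, ?_⟩
  ext <;> grind [paramPair₂]

theorem Good.not_realizes_codeEmpty₁ (hq : q.Good) : ¬ q.Realizes codeEmpty₁ := by
  intro h
  obtain ⟨hμ, hν⟩ := h.eq_diagonal rfl rfl
  have e₁ : 1 = q.κ * 0 + q.γ₀ := (h.cell 0 0 1).2 rfl
  have e₂ : q.t = q.κ * 1 + q.γ₀ := (h.cell 0 1 2).2 rfl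
  have e₃ : 0 = q.κ * 1 + q.γ₁ := (h.cell 1 1 0).2 rfl
  have e₄ : 1 = q.κ * q.s + q.γ₁ := (h.cell 1 2 1).2 rfl
  have e₅ : q.κ * q.s + q.γ₀ = q.μ * q.s + q.ν := (h.col 0 2).2 rfl
  have e₆ : q.μ * (q.t - q.γ₁) = q.κ * (q.t - q.ν) := (h.row 1 2).2 rfl
  have h₁ : q.t ^ 2 - q.t - 1 = 0 := by grind
  have h₂ : q.t ^ 2 - 3 * q.t + 1 = 0 := by grind
  exact hq.t1 (by linear_combination (h₁ - h₂) / 2)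

theorem Good.not_realizes_codeEmpty₂ (hq : q.Good) : ¬ q.Realizes codeEmpty₂ := by
  intro h
  obtain ⟨hμ, hν⟩ := h.eq_diagonal rfl rfl
  have e₁ : 1 = q.κ * 0 + q.γ₀ := (h.cell 0 0 1).2 rfl
  have e₂ : q.t = q.κ * 1 + q.γ₀ := (h.cell 0 1 2).2 rfl
  have e₃ : 0 = q.κ * 1 + q.γ₁ := (h.cell 1 1 0).2 rfl
  have e₄ : 1 = q.κ * q.s + q.γ₁ := (h.cell 1 2 1).2 rfl
  have e₅ : q.t = q.μ * q.s + q.ν := (h.cell 2 2 2).2 rfl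
  have hs2 : q.s = 2 := by grind [hq.s0]
  exact hq.κμ (by grind)

theorem not_realizes_codeEmpty₃ : ¬ q.Realizes codeEmpty₃ := by
  intro h
  obtain ⟨hμ, hν⟩ := h.eq_diagonal rfl rfl
  have e₁ : 1 = q.κ * 0 + q.γ₀ := (h.cell 0 0 1).2 rfl
  have e₂ : 0 = q.κ * 1 + q.γ₀ := (h.cell 0 1 0).2 rfl
  have e₃ : q.t = q.κ * 0 + q.γ₁ := (h.cell 1 0 2).2 rfl
  have e₄ : 1 = q.κ * q.s + q.γ₁ := (h.cell 1 2 1).2 rfl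
  have e₅ : q.t = q.μ * q.s + q.ν := (h.cell 2 2 2).2 rfl
  grind

theorem not_realizes_codeEmpty₄ : ¬ q.Realizes codeEmpty₄ := by
  intro h
  obtain ⟨hμ, hν⟩ := h.eq_diagonal rfl rfl
  have e₁ : 1 = q.κ * 0 + q.γ₀ := (h.cell 0 0 1).2 rfl
  have e₂ : q.t = q.κ * 1 + q.γ₀ := (h.cell 0 1 2).2 rfl
  have e₃ : 0 = q.κ * q.s + q.γ₀ := (h.cell 0 2 0).2 rfl
  have e₄ : 0 = q.κ * 1 + q.γ₁ := (h.cell 1 1 0).2 rfl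
  have e₅ : 1 = q.κ * q.s + q.γ₁ := (h.cell 1 2 1).2 rfl
  have e₆ : q.μ * (q.t - q.γ₁) = q.κ * (q.t - q.ν) := (h.row 1 2).2 rfl
  have ht : q.t = -1 := by linear_combination e₂ - e₃ - e₄ + e₅
  grind

theorem not_realizes_codeEmpty₅ : ¬ q.Realizes codeEmpty₅ := by
  intro h
  obtain ⟨hμ, hν⟩ := h.eq_diagonal rfl rfl
  have e₁ : 1 = q.κ * 0 + q.γ₀ := (h.cell 0 0 1).2 rfl
  have e₂ : q.t = q.κ * 1 + q.γ₀ := (h.cell 0 1 2).2 rfl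
  have e₃ : 0 = q.κ * q.s + q.γ₀ := (h.cell 0 2 0).2 rfl
  have e₄ : 0 = q.κ * 1 + q.γ₁ := (h.cell 1 1 0).2 rfl
  have e₅ : 1 = q.κ * q.s + q.γ₁ := (h.cell 1 2 1).2 rfl
  have e₆ : q.t = q.μ * q.s + q.ν := (h.cell 2 2 2).2 rfl
  have ht : q.t = -1 := by linear_combination e₂ - e₃ - e₄ + e₅
  grind

theorem not_realizes_codeEmpty₆ : ¬ q.Realizes codeEmpty₆ := by
  intro h
  obtain ⟨hμ, hν⟩ := h.eq_diagonal rfl rfl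
  have e₁ : 1 = q.κ * 0 + q.γ₀ := (h.cell 0 0 1).2 rfl
  have e₂ : q.t = q.κ * 1 + q.γ₀ := (h.cell 0 1 2).2 rfl
  have e₃ : 0 = q.κ * q.s + q.γ₀ := (h.cell 0 2 0).2 rfl
  have e₄ : q.t = q.κ * 0 + q.γ₁ := (h.cell 1 0 2).2 rfl
  have e₅ : 0 = q.κ * 1 + q.γ₁ := (h.cell 1 1 0).2 rfl
  have e₆ : q.t = q.μ * q.s + q.ν := (h.cell 2 2 2).2 rfl
  grind

theorem good_param₁ {t : ℂ} (ht : t ∈ par₁) : (param₁ t).Good := by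
  rw [mem_par₁_iff] at ht
  constructor <;> grind [param₁]

theorem good_param₂ {t : ℂ × ℂ} (ht : t ∈ par₂) : (param₂ t).Good := by
  obtain ⟨h₁, h₂⟩ := ht
  constructor <;> grind [param₂]

theorem good_param₃ {t : ℂ} (ht : t ∈ par₃) : (param₃ t).Good := by
  rw [mem_par₃_iff] at ht
  constructor <;> grind [param₃]

theorem good_param₄ {s : ℂ} (hs : s ∈ par₄) : (param₄ s).Good := by
  rw [mem_par₄_iff] at hs
  constructor <;> grind [param₄]

theorem good_paramCurve {s : ℂ} (hs : s ∈ curveParams) : (paramCurve s).Good := by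
  simp only [curveParams, Set.mem_compl_iff, Set.mem_insert_iff, Set.mem_singleton_iff] at hs
  constructor <;> grind [paramCurve]

theorem realizes_param₁ {t : ℂ} (ht : t ∈ par₁) : (param₁ t).Realizes code₁ := by
  rw [mem_par₁_iff] at ht
  constructor <;> intro k i
  on_goal 1 => intro j; fin_cases j
  all_goals
    fin_cases k <;> fin_cases i <;>
      simp only [param₁, a, b, slope, icept, code₁, Matrix.cons_val, Fin.mk_zero, Fin.mk_one,
        Fin.reduceFinMk, Fin.castSucc_zero, Fin.castSucc_one] <;>
      grind

theorem realizes_param₂ {t : ℂ × ℂ} (ht : t ∈ par₂) : (param₂ t).Realizes code₂ := by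
  obtain ⟨h₁, h₂⟩ := ht
  constructor <;> intro k i
  on_goal 1 => intro j; fin_cases j
  all_goals
    fin_cases k <;> fin_cases i <;>
      simp only [param₂, a, b, slope, icept, code₂, Matrix.cons_val, Fin.mk_zero, Fin.mk_one,
        Fin.reduceFinMk, Fin.castSucc_zero, Fin.castSucc_one] <;>
      grind

theorem realizes_param₃ {t : ℂ} (ht : t ∈ par₃) : (param₃ t).Realizes code₃ := by
  rw [mem_par₃_iff] at ht
  constructor <;> intro k i
  on_goal 1 => intro j; fin_cases j
  all_goals
    fin_cases k <;> fin_cases i <;>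
      simp only [param₃, a, b, slope, icept, code₃, Matrix.cons_val, Fin.mk_zero, Fin.mk_one,
        Fin.reduceFinMk, Fin.castSucc_zero, Fin.castSucc_one] <;>
      grind

theorem realizes_param₄ {s : ℂ} (hs : s ∈ par₄) : (param₄ s).Realizes code₄ := by
  rw [mem_par₄_iff] at hs
  constructor <;> intro k i
  on_goal 1 => intro j; fin_cases j
  all_goals
    fin_cases k <;> fin_cases i <;>
      simp only [param₄, a, b, slope, icept, code₄, Matrix.cons_val, Fin.mk_zero, Fin.mk_one,
        Fin.reduceFinMk, Fin.castSucc_zero, Fin.castSucc_one] <;>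
      grind

theorem realizes_paramCurve {s : ℂ} (hs : s ∈ curveParams) : (paramCurve s).Realizes codeCurve := by
  simp only [curveParams, Set.mem_compl_iff, Set.mem_insert_iff, Set.mem_singleton_iff] at hs
  constructor <;> intro k i
  on_goal 1 => intro j; fin_cases j
  all_goals
    fin_cases k <;> fin_cases i <;>
      simp only [paramCurve, a, b, slope, icept, codeCurve, Matrix.cons_val, Fin.mk_zero,
        Fin.mk_one, Fin.reduceFinMk, Fin.castSucc_zero, Fin.castSucc_one] <;>
      grind

end Param

/-! ### Uniqueness of the normal form -/

theorem smul_eq_self_of_frame (g : V ≃ₗ[ℂ] V) (h₁ : g • vertical 0 = vertical 0)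
    (h₂ : g • vertical 1 = vertical 1) (h₃ : g • horizontal 0 = horizontal 0)
    (h₄ : g • horizontal 1 = horizontal 1) (h₅ : g • infinity = infinity) (l : ℙ ℂ V) :
    g • l = l := by
  obtain ⟨c₁, h₁ : c₁ • ![1, 0, -0] = g ![1, 0, -0]⟩ := (mk_eq_mk_iff' ℂ _ _ _ _).1 h₁
  obtain ⟨c₂, h₂ : c₂ • ![1, 0, -1] = g ![1, 0, -1]⟩ := (mk_eq_mk_iff' ℂ _ _ _ _).1 h₂
  obtain ⟨c₃, h₃ : c₃ • ![0, 1, -0] = g ![0, 1, -0]⟩ := (mk_eq_mk_iff' ℂ _ _ _ _).1 h₃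
  obtain ⟨c₄, h₄ : c₄ • ![0, 1, -1] = g ![0, 1, -1]⟩ := (mk_eq_mk_iff' ℂ _ _ _ _).1 h₄
  obtain ⟨c₅, h₅ : c₅ • ![0, 0, 1] = g ![0, 0, 1]⟩ := (mk_eq_mk_iff' ℂ _ _ _ _).1 h₅
  have hg (v : V) : g v = ![c₁ * v 0, c₃ * v 1, c₅ * v 2] := by
    have hv : v = v 0 • ![1, 0, -0] + v 1 • ![0, 1, -0] + v 2 • ![0, 0, 1] := by
      ext i
      fin_cases i <;> simp
    conv_lhs => rw [hv]
    rw [map_add, map_add, map_smul, map_smul, map_smul, ← h₁, ← h₃, ← h₅]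
    ext i
    fin_cases i <;> simp [mul_comm]
  have h₁₅ : c₁ = c₅ := by
    have h₀ : c₂ * 1 = c₁ * 1 := congrFun (h₂.trans (hg _)) 0
    have h₂ : c₂ * -1 = c₅ * -1 := congrFun (h₂.trans (hg _)) 2
    linear_combination -h₀ - h₂
  have h₃₅ : c₃ = c₅ := by
    have h₁ : c₄ * 1 = c₃ * 1 := congrFun (h₄.trans (hg _)) 1
    have h₂ : c₄ * -1 = c₅ * -1 := congrFun (h₄.trans (hg _)) 2
    linear_combination -h₁ - h₂
  induction l with | h v hv =>
  rw [smul_mk]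
  refine mk_eq_of_smul c₅ fun i => ?_
  change c₅ * v i = g v i
  rw [hg, h₁₅, h₃₅]
  fin_cases i <;> rfl

namespace Param

variable {q q' : Param}

theorem eq_of_lines_eq (h : q.lines = q'.lines) : q = q' := by
  have hcoef (l : Label) : ∃ c : ℂ, ∀ i, c * q'.coef l i = q.coef l i := by
    obtain ⟨c, hc⟩ := (mk_eq_mk_iff' ℂ _ _ _ _).1 (congrFun h l)
    exact ⟨c, fun i => congrFun hc i⟩
  have ha (i : Fin 3) : q.a i = q'.a i := by
    obtain ⟨c, hc⟩ := hcoef (col i)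
    have h₀ : c * 1 = 1 := hc 0
    have h₂ : c * -q'.a i = -q.a i := hc 2
    linear_combination q'.a i * h₀ + h₂
  have hb (j : Fin 3) : q.b j = q'.b j := by
    obtain ⟨c, hc⟩ := hcoef (row j)
    have h₁ : c * 1 = 1 := hc 1
    have h₂ : c * -q'.b j = -q.b j := hc 2
    linear_combination q'.b j * h₁ + h₂
  have hobl (k : Fin 3) : q.slope k = q'.slope k ∧ q.icept k = q'.icept k := by
    obtain ⟨c, hc⟩ := hcoef (obl k)
    have h₀ : c * -q'.slope k = -q.slope k := hc 0
    have h₁ : c * 1 = 1 := hc 1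
    have h₂ : c * -q'.icept k = -q.icept k := hc 2
    exact ⟨by linear_combination q'.slope k * h₁ + h₀, by linear_combination q'.icept k * h₁ + h₂⟩
  ext
  exacts [ha 2, hb 2, (hobl 0).1, (hobl 0).2, (hobl 1).2, (hobl 2).1, (hobl 2).2]

theorem eq_of_smul_lines (g : V ≃ₗ[ℂ] V) (h : ∀ l, g • q'.lines l = q.lines l) : q = q' := by
  refine eq_of_lines_eq (funext fun l => ?_)
  rw [← h, smul_eq_self_of_frame g (h (col 0)) (h (col 1)) (h (row 0)) (h (row 1)) (h inf)]

/-- The parameters of the complex conjugate arrangement. -/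
def conj (q : Param) : Param :=
  ⟨star q.s, star q.t, star q.κ, star q.γ₀, star q.γ₁, star q.μ, star q.ν⟩

theorem conj_lines (q : Param) (e : Label ≃ Fin 10) :
    LineArrangement.conj (q.lines ∘ e.symm) = q.conj.lines ∘ e.symm := by
  funext i
  simp only [LineArrangement.conj, Function.comp_apply, lines, map_mk]
  congr 1
  change star (q.coef _) = _
  rcases e.symm i with i | i | _ | i
  on_goal 1 => fin_cases i
  on_goal 4 => fin_cases i
  on_goal 8 => fin_cases i
  all_goals
    ext j
    fin_cases j <;> simp [coef, a, b, slope, icept, conj]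

end Param

theorem Base.injective {A : Lines 10} {e : Label ≃ Fin 10} (hA : Base (A ∘ e)) :
    Function.Injective A := by
  simpa using hA.inj.comp e.symm.injective

theorem Base.sameLattice_lines {A : Lines 10} {e : Label ≃ Fin 10} {c : Code} {q : Param}
    (hA : Base (A ∘ e)) (hc : HasCode (A ∘ e) c) (hq : q.Good) (hqc : q.Realizes c) :
    SameLattice A (q.lines ∘ e.symm) := by
  refine sameLattice_of_conc_iff hA.injective (hq.base.inj.comp e.symm.injective) fun i j k => ?_
  simpa using hA.conc_congr hq.base hc (Param.hasCode_lines_iff.2 hqc) (e.symm i) (e.symm j)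
    (e.symm k)

theorem SameLattice.exists_param {A B : Lines 10} (hAB : SameLattice A B) {e : Label ≃ Fin 10}
    {c : Code} (hA : Base (A ∘ e)) (hc : HasCode (A ∘ e) c) :
    ∃ q : Param, q.Good ∧ q.Realizes c ∧ projSetoid 10 (q.lines ∘ e.symm) B := by
  have hconc (x y z : Label) := hAB.conc_iff (e x) (e y) (e z)
  have hB : Base (B ∘ e) :=
    ⟨(hAB.injective hA.injective).comp e.injective,
      fun {x y} hx hy => (hconc x y inf).symm.trans (hA.conc_inf_iff hx hy)⟩
  obtain ⟨g, q, hq, hg⟩ := hB.exists_param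
  have hconc' (x y z : Label) : Conc (q.lines x) (q.lines y) (q.lines z) ↔
      Conc ((A ∘ e) x) ((A ∘ e) y) ((A ∘ e) z) := by
    rw [← hg, ← hg, ← hg, conc_smul_iff]
    exact (hconc x y z).symm
  refine ⟨q, hq, Param.hasCode_lines_iff.1 ⟨fun k i j => (hconc' _ _ _).trans (hc.cell k i j),
    fun b x => (hconc' _ _ _).trans (hc.meet b x)⟩, projSetoid_iff.2 ⟨g, fun i => ?_⟩⟩
  simpa using hg (e.symm i)

/-! ### Moduli spaces parametrized by a family -/

section Moduli

variable {n : ℕ}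

theorem Moduli.mk_eq_mk_iff {A : Lines n} {B C : Realization A} :
    Moduli.mk B = Moduli.mk C ↔ projSetoid n B.val C.val :=
  Quotient.eq

theorem conj_mk_eq_mk_iff {v : V} (hv : v ≠ 0) :
    Projectivization.map conjV conjV_injective (mk ℂ v hv) = mk ℂ v hv ↔
      ∃ (w : Fin 3 → ℝ) (hw : (fun j => (w j : ℂ)) ≠ 0), mk ℂ v hv = mk ℂ _ hw := by
  constructor
  · intro h
    obtain ⟨i, hi⟩ := Function.ne_iff.1 hv
    obtain ⟨c, hc⟩ := (mk_eq_mk_iff' ℂ _ _ _ _).1 h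
    have hc (j : Fin 3) : c * v j = star (v j) := congrFun hc j
    have hreal (j : Fin 3) : ((v j / v i).re : ℂ) = v j / v i := by
      refine Complex.conj_eq_iff_re.1 ?_
      have hi' : star (v i) ≠ 0 := star_ne_zero.2 hi
      rw [starRingEnd_apply, star_div₀, div_eq_div_iff hi' hi, ← hc, ← hc]
      ring
    refine ⟨fun j => (v j / v i).re, fun h0 => ?_, mk_eq_of_smul (v i) fun j => ?_⟩
    · have := congrFun h0 i
      rw [hreal, div_self hi] at this
      exact one_ne_zero this
    · rw [hreal, mul_div_cancel₀ _ hi]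
  · rintro ⟨w, hw, h⟩
    rw [h, map_mk]
    congr 1
    ext j
    exact Complex.conj_ofReal _

theorem conj_eq_self_iff {A : Lines n} : conj A = A ↔
    ∀ i, ∃ (v : Fin 3 → ℝ) (h : (fun j => (v j : ℂ)) ≠ 0), A i = mk ℂ (fun j => (v j : ℂ)) h := by
  refine funext_iff.trans (forall_congr' fun i => ?_)
  simp only [conj]
  induction A i with | h v hv =>
  exact conj_mk_eq_mk_iff hv

/-- The family `fam` of arrangements with parameters in `par` is a set of representatives of the
moduli space of each of its members, and conjugation acts through the parameters. -/
structure ParametrizesModuli {ι : Type} [Star ι] (fam : ι → Lines n) (par : Set ι) : Prop where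
  sameLattice_iff : ∀ t ∈ par, ∀ B, SameLattice (fam t) B ↔ ∃ s ∈ par, projSetoid n (fam s) B
  eq_of_proj : ∀ s t, projSetoid n (fam s) (fam t) → s = t
  conj_fam : ∀ t, conj (fam t) = fam (star t)

namespace ParametrizesModuli

variable {ι : Type} [Star ι] {fam : ι → Lines n} {par : Set ι} {t : ι}

/-- The member of the family with parameter `s`, as a realization of the lattice of `fam t`. -/
def realization (h : ParametrizesModuli fam par) (ht : t ∈ par) (s : par) : Realization (fam t) :=
  ⟨fam s, (h.sameLattice_iff t ht _).2 ⟨s, s.2, (projSetoid n).refl _⟩⟩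

theorem bijective_mk_realization (h : ParametrizesModuli fam par) (ht : t ∈ par) :
    Function.Bijective fun s => Moduli.mk (h.realization ht s) := by
  constructor
  · intro s s' hs
    exact Subtype.ext (h.eq_of_proj _ _ (Moduli.mk_eq_mk_iff.1 hs))
  · rintro ⟨B⟩
    obtain ⟨s, hs, hB⟩ := (h.sameLattice_iff t ht B.val).1 B.2
    exact ⟨⟨s, hs⟩, Moduli.mk_eq_mk_iff.2 hB⟩

/-- The parameters correspond to the points of the moduli space. -/
def moduliEquiv (h : ParametrizesModuli fam par) (ht : t ∈ par) : par ≃ Moduli (fam t) :=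
  Equiv.ofBijective _ (h.bijective_mk_realization ht)

theorem eq_star_of_proj_conj (h : ParametrizesModuli fam par) {s s' : ι} {B : Lines n}
    (hs : projSetoid n B (fam s)) (hs' : projSetoid n (conj B) (fam s')) : s' = star s := by
  have hconj := projSetoid_conj hs
  rw [h.conj_fam] at hconj
  exact h.eq_of_proj _ _ ((projSetoid n).trans ((projSetoid n).symm hs') hconj)

theorem isRealPoint_moduliEquiv_iff (h : ParametrizesModuli fam par) (ht : t ∈ par) (s : par) :
    IsRealPoint (h.moduliEquiv ht s) ↔ star s.1 = s.1 := by
  constructor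
  · rintro ⟨B, hB, hreal⟩
    have hs : projSetoid n B.val (fam s) := Moduli.mk_eq_mk_iff.1 hB
    refine (h.eq_star_of_proj_conj hs ?_).symm
    rwa [conj_eq_self_iff.2 hreal]
  · intro hs
    refine ⟨h.realization ht s, rfl, conj_eq_self_iff.1 ?_⟩
    exact (h.conj_fam s).trans (congrArg fam hs)

/-- The conjugation classes of parameters correspond to the points of the quotient of the moduli
space by complex conjugation. -/
def moduliConjEquiv (h : ParametrizesModuli fam par) (ht : t ∈ par) :
    Quot (fun s s' : par => s'.1 = star s.1) ≃ ModuliConj (fam t) :=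
  Quot.congr (h.moduliEquiv ht) fun s s' => by
    constructor
    · intro hs
      refine ⟨h.realization ht s, h.realization ht s', rfl, rfl, ?_⟩
      exact (congrArg fam hs).trans (h.conj_fam s).symm
    · rintro ⟨B, B', hB, hB', hBB'⟩
      have hs' : projSetoid n B'.val (fam s') := Moduli.mk_eq_mk_iff.1 hB'
      exact h.eq_star_of_proj_conj (Moduli.mk_eq_mk_iff.1 hB) (hBB' ▸ hs')

end ParametrizesModuli

end Moduli

theorem card_quot_star {ι : Type} [InvolutiveStar ι] (par : Set ι) :
    Nat.card (Quot fun s s' : par => s'.1 = star s.1) =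
      ((fun s => ({s, star s} : Set ι)) '' par).ncard := by
  let f : Quot (fun s s' : par => s'.1 = star s.1) → Set ι :=
    Quot.lift (fun s => {s.1, star s.1}) fun s s' h => by
      simp only [h, star_star, Set.pair_comm]
  have hf : Function.Injective f := by
    rintro ⟨s⟩ ⟨s'⟩ h
    obtain hs | hs : s'.1 ∈ ({s.1, star s.1} : Set ι) := (Set.ext_iff.1 h s'.1).2 (Or.inl rfl)
    · rw [Subtype.ext hs]
    · exact Quot.sound hs
  rw [← Nat.card_range_of_injective hf, Nat.card_coe_set_eq]
  congr 1
  ext S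
  constructor
  · rintro ⟨⟨s⟩, rfl⟩
    exact ⟨s, s.2, rfl⟩
  · rintro ⟨s, hs, rfl⟩
    exact ⟨Quot.mk _ ⟨s, hs⟩, rfl⟩

namespace ParametrizesModuli

variable {ι : Type} [InvolutiveStar ι] {fam : ι → Lines 10} {par : Set ι} {a b : ι}

theorem hasModuli (h : ParametrizesModuli fam par) :
    HasModuli fam par par.ncard {s | s ∈ par ∧ star s = s}.ncard
      ((fun s => ({s, star s} : Set ι)) '' par).ncard := by
  intro t ht
  refine ⟨h.sameLattice_iff t ht, ?_, ?_, ?_⟩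
  · rw [← Nat.card_coe_set_eq, Nat.card_congr (h.moduliEquiv ht)]
  · rw [← Nat.card_coe_set_eq, ← Nat.card_congr ((h.moduliEquiv ht).subtypeEquiv fun s =>
      (h.isRealPoint_moduliEquiv_iff ht s).symm)]
    exact Nat.card_congr (Equiv.subtypeSubtypeEquivSubtypeInter (· ∈ par) fun s => star s = s)
  · rw [← card_quot_star, Nat.card_congr (h.moduliConjEquiv ht)]

theorem hasModuli_of_eq_pair (h : ParametrizesModuli fam par) (hpar : par = {a, b}) (hab : a ≠ b)
    (ha : star a = a) (hb : star b = b) : HasModuli fam par 2 2 2 := by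
  have hreal : {s | s ∈ par ∧ star s = s} = par := by
    refine Set.sep_eq_self_iff_mem_true.2 ?_
    simp [hpar, ha, hb]
  have hconj : (fun s => ({s, star s} : Set ι)) '' par = {{a}, {b}} := by
    rw [hpar, Set.image_pair, ha, hb, Set.pair_eq_singleton, Set.pair_eq_singleton]
  have hcard : par.ncard = 2 := hpar ▸ Set.ncard_pair hab
  have hcard' : ({{a}, {b}} : Set (Set ι)).ncard = 2 := Set.ncard_pair (by simpa using hab)
  simpa only [hreal, hconj, hcard, hcard'] using h.hasModuli

theorem hasModuli_of_eq_triple (h : ParametrizesModuli fam par) (hpar : par = {a, b, star b})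
    (ha : star a = a) (hb : star b ≠ b) : HasModuli fam par 3 1 2 := by
  have hab : a ≠ b := fun h => hb (h ▸ ha)
  have hab' : a ≠ star b := fun h => hab (by rw [← ha, h, star_star])
  have hreal : {s | s ∈ par ∧ star s = s} = {a} := by
    ext s
    simp only [hpar, Set.mem_ofPred_eq, Set.mem_insert_iff, Set.mem_singleton_iff]
    constructor
    · rintro ⟨rfl | rfl | rfl, hs⟩
      · rfl
      · exact absurd hs hb
      · exact absurd ((star_star b).symm.trans hs).symm hb
    · rintro rfl
      exact ⟨Or.inl rfl, ha⟩
  have hconj : (fun s => ({s, star s} : Set ι)) '' par = {{a}, {b, star b}} := by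
    rw [hpar, Set.image_insert_eq, Set.image_pair, star_star, Set.pair_comm (star b) b,
      Set.pair_eq_singleton {b, star b}, ha, Set.pair_eq_singleton]
  have hcard : par.ncard = 3 := Set.ncard_eq_three.2 ⟨a, b, star b, hab, hab', hb.symm, hpar⟩
  have hcard' : ({{a}, {b, star b}} : Set (Set ι)).ncard = 2 :=
    Set.ncard_pair fun h => hab ((Set.ext_iff.1 h b).2 (Or.inl rfl)).symm
  simpa only [hreal, hconj, hcard, hcard', Set.ncard_singleton] using h.hasModuli

end ParametrizesModuli

/-! ### The moduli spaces of the four families -/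

/-- The members of the family `fam` with parameters in `par` are, with the lines labelled through
`e`, exactly the arrangements in normal form with the code `c`; the parameters in normal form of
`fam t` are `p t`. -/
structure IsSolution {ι : Type} [Star ι] (fam : ι → Lines 10) (par : Set ι) (e : Label ≃ Fin 10)
    (c : Code) (p : ι → Param) : Prop where
  fam_eq : ∀ t, fam t = (p t).lines ∘ e.symm
  conj_eq : ∀ t, (p t).conj = p (star t)
  inj : Function.Injective p
  good : ∀ t ∈ par, (p t).Good
  realizes : ∀ t ∈ par, (p t).Realizes c
  solve : ∀ q : Param, q.Good → q.Realizes c → ∃ t ∈ par, q = p t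

namespace IsSolution

variable {ι : Type} [Star ι] {fam : ι → Lines 10} {par : Set ι} {e : Label ≃ Fin 10} {c : Code}
  {p : ι → Param}

theorem fam_comp_eq (h : IsSolution fam par e c p) (t : ι) : fam t ∘ e = (p t).lines := by
  rw [h.fam_eq, Function.comp_assoc, e.symm_comp_self, Function.comp_id]

theorem sameLattice_iff (h : IsSolution fam par e c p) {t : ι} (ht : t ∈ par) (B : Lines 10) :
    SameLattice (fam t) B ↔ ∃ s ∈ par, projSetoid 10 (fam s) B := by
  have hbase : Base (fam t ∘ e) := h.fam_comp_eq t ▸ (h.good t ht).base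
  have hcode : HasCode (fam t ∘ e) c :=
    h.fam_comp_eq t ▸ Param.hasCode_lines_iff.2 (h.realizes t ht)
  constructor
  · intro hB
    obtain ⟨q, hq, hqc, hqB⟩ := hB.exists_param hbase hcode
    obtain ⟨s, hs, rfl⟩ := h.solve q hq hqc
    exact ⟨s, hs, h.fam_eq s ▸ hqB⟩
  · rintro ⟨s, hs, hB⟩
    have hlat : SameLattice (fam t) (fam s) :=
      h.fam_eq s ▸ hbase.sameLattice_lines hcode (h.good s hs) (h.realizes s hs)
    exact hlat.trans (sameLattice_of_proj (hlat.injective hbase.injective) hB)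

theorem parametrizesModuli (h : IsSolution fam par e c p) : ParametrizesModuli fam par where
  sameLattice_iff _ := h.sameLattice_iff
  eq_of_proj s t hst := by
    obtain ⟨g, hg⟩ := projSetoid_iff.1 hst
    refine h.inj (Param.eq_of_smul_lines g fun l => ?_)
    simpa [h.fam_eq] using hg (e l)
  conj_fam t := by rw [h.fam_eq, h.fam_eq, Param.conj_lines, h.conj_eq]

end IsSolution

/-- The position of the lines among the ten factors of the first equation. -/
def index₁ : Label ≃ Fin 10 where
  toFun
    | col i => ![0, 3, 5] i
    | row j => ![1, 4, 6] j
    | inf => 2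
    | obl k => ![7, 8, 9] k
  invFun := ![col 0, row 0, inf, col 1, row 1, col 2, row 2, obl 0, obl 1, obl 2]
  left_inv := by decide
  right_inv := by decide

/-- The position of the lines among the ten factors of the other three equations, whose last two
lines are the parallel ones. -/
def index₂ : Label ≃ Fin 10 where
  toFun
    | col i => ![0, 3, 5] i
    | row j => ![1, 4, 6] j
    | inf => 2
    | obl k => ![8, 9, 7] k
  invFun := ![col 0, row 0, inf, col 1, row 1, col 2, row 2, obl 2, obl 0, obl 1]
  left_inv := by decide
  right_inv := by decide

open Code

theorem isSolution₁ : IsSolution fam₁ par₁ index₁ code₁ param₁ where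
  fam_eq t := by
    refine funext fun i => mk_eq_of_smul 1 fun j => ?_
    fin_cases i <;> fin_cases j <;>
      simp [index₁, coeffs₁, Param.coef, Param.a, Param.b, Param.slope, Param.icept, param₁]
  conj_eq t := by simp [Param.conj, param₁]
  inj s t h := congrArg Param.s h
  good _ := Param.good_param₁
  realizes _ := Param.realizes_param₁
  solve _ _ h := h.eq_param₁

theorem isSolution₂ : IsSolution fam₂ par₂ index₂ code₂ param₂ where
  fam_eq t := by
    refine funext fun i => mk_eq_of_smul 1 fun j => ?_
    fin_cases i <;> fin_cases j <;>
      simp [index₂, coeffs₂, Param.coef, Param.a, Param.b, Param.slope, Param.icept, param₂]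
  conj_eq t := by simp [Param.conj, param₂]
  inj s t h := Prod.ext (congrArg Param.s h) (congrArg Param.t h)
  good _ := Param.good_param₂
  realizes _ := Param.realizes_param₂
  solve _ _ h := h.eq_param₂

theorem isSolution₃ : IsSolution fam₃ par₃ index₂ code₃ param₃ where
  fam_eq t := by
    refine funext fun i => mk_eq_of_smul 1 fun j => ?_
    fin_cases i <;> fin_cases j <;>
      simp [index₂, coeffs₃, Param.coef, Param.a, Param.b, Param.slope, Param.icept, param₃]
  conj_eq t := by simp [Param.conj, param₃]
  inj s t h := congrArg Param.t h
  good _ := Param.good_param₃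
  realizes _ := Param.realizes_param₃
  solve _ hq h := h.eq_param₃ hq

theorem isSolution₄ : IsSolution fam₄ par₄ index₂ code₄ param₄ where
  fam_eq t := by
    refine funext fun i => mk_eq_of_smul 1 fun j => ?_
    fin_cases i <;> fin_cases j <;>
      simp [index₂, coeffs₄, Param.coef, Param.a, Param.b, Param.slope, Param.icept, param₄]
  conj_eq t := by simp [Param.conj, param₄]
  inj s t h := congrArg Param.κ h
  good _ := Param.good_param₄
  realizes _ := Param.realizes_param₄
  solve _ _ h := h.eq_param₄

theorem hasModuli₁ : HasModuli fam₁ par₁ 2 2 2 := by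
  refine isSolution₁.parametrizesModuli.hasModuli_of_eq_pair rfl (fun h => ?_) (by simp) (by simp)
  have h5 : ((√5 : ℝ) : ℂ) = 0 := by linear_combination h
  simp at h5

theorem hasModuli₃ : HasModuli fam₃ par₃ 2 2 2 := by
  refine isSolution₃.parametrizesModuli.hasModuli_of_eq_pair rfl (fun h => ?_) (by simp) (by simp)
  have h5 : ((√5 : ℝ) : ℂ) = 0 := by linear_combination h
  simp at h5

theorem hasModuli₄ : HasModuli fam₄ par₄ 2 2 2 := by
  refine isSolution₄.parametrizesModuli.hasModuli_of_eq_pair rfl (fun h => ?_) (by simp) (by simp)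
  have h2 : ((√2 : ℝ) : ℂ) = 0 := by linear_combination h / 2
  simp at h2

theorem exists_cubic_root : ∃ r : ℝ, r ^ 3 - r ^ 2 + 1 = 0 ∧ r < -1 / 3 := by
  obtain ⟨r, hr, h0⟩ := intermediate_value_Ioo (a := (-1 : ℝ)) (b := -1 / 3)
    (f := fun u => u ^ 3 - u ^ 2 + 1) (by norm_num) (by fun_prop)
    (show (0 : ℝ) ∈ _ by constructor <;> norm_num)
  exact ⟨r, h0, hr.2⟩

theorem exists_cubic_roots : ∃ (r : ℝ) (z : ℂ), star z ≠ z ∧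
    ∀ u : ℂ, u ^ 3 - u ^ 2 + 1 = 0 ↔ u = r ∨ u = z ∨ u = star z := by
  obtain ⟨r, hr, hr3⟩ := exists_cubic_root
  -- The cofactor `u² + (r - 1) u + r (r - 1)` of `u - r` has discriminant `-(1 - r) (-1 - 3 r)`.
  have hdisc : 0 < (1 - r) * (-1 - 3 * r) := mul_pos (by linarith) (by linarith)
  obtain ⟨d, hd0, hd⟩ : ∃ d : ℝ, d ≠ 0 ∧ d ^ 2 = (1 - r) * (-1 - 3 * r) :=
    ⟨_, (Real.sqrt_pos.2 hdisc).ne', Real.sq_sqrt hdisc.le⟩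
  have hstar : star ((1 - r + d * Complex.I) / 2) = (1 - r - d * Complex.I) / 2 := by
    simp [sub_eq_add_neg]
  refine ⟨r, (1 - r + d * Complex.I) / 2, fun h => ?_, fun u => ?_⟩
  · rw [hstar] at h
    exact mul_ne_zero (Complex.ofReal_ne_zero.2 hd0) Complex.I_ne_zero (by linear_combination -h)
  · have hr : (r : ℂ) ^ 3 - r ^ 2 + 1 = 0 := mod_cast hr
    have hd : (d : ℂ) ^ 2 = (1 - r) * (-1 - 3 * r) := mod_cast hd
    have hfactor : u ^ 3 - u ^ 2 + 1 = (u - r) * ((u - (1 - r + d * Complex.I) / 2) *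
        (u - (1 - r - d * Complex.I) / 2)) := by
      linear_combination hr + (u - r) * d ^ 2 * Complex.I_sq / 4 - (u - r) * hd / 4
    rw [hstar, hfactor, mul_eq_zero, mul_eq_zero, sub_eq_zero, sub_eq_zero, sub_eq_zero]

theorem hasModuli₂ : HasModuli fam₂ par₂ 3 1 2 := by
  obtain ⟨r, z, hz, hroot⟩ := exists_cubic_roots
  refine isSolution₂.parametrizesModuli.hasModuli_of_eq_triple (a := ((r : ℂ) ^ 2, (r : ℂ) + 1))
    (b := (z ^ 2, z + 1)) ?_ (by simp [Prod.star_def]) fun h => ?_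
  · ext ⟨t₁, t₂⟩
    simp only [par₂, Set.mem_ofPred_eq, hroot, Set.mem_insert_iff, Set.mem_singleton_iff,
      Prod.mk.injEq, Prod.star_def, star_pow, star_add, star_one, sub_eq_iff_eq_add]
    constructor
    · rintro ⟨rfl, rfl | rfl | rfl⟩ <;> simp
    · rintro (⟨rfl, rfl⟩ | ⟨rfl, rfl⟩ | ⟨rfl, rfl⟩) <;> simp
  · exact hz (by simpa using congrArg Prod.snd h)

/-! ### Irreducibility of the remaining moduli spaces -/

/-- The class of a realization in the quotient of the moduli space by complex conjugation. -/
def ModuliConj.mk {n : ℕ} {A : Lines n} (B : Realization A) : ModuliConj A :=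
  Quot.mk _ (Moduli.mk B)

section ModuliConj

variable {n : ℕ} {A : Lines n}

theorem ModuliConj.continuous_mk : Continuous (ModuliConj.mk (A := A)) :=
  continuous_quot_mk.comp continuous_quot_mk

theorem ModuliConj.surjective_mk : Function.Surjective (ModuliConj.mk (A := A)) := by
  rintro ⟨⟨B⟩⟩
  exact ⟨B, rfl⟩

theorem ModuliConj.mk_eq_mk_of_proj {B C : Realization A} (h : projSetoid n B.val C.val) :
    ModuliConj.mk B = ModuliConj.mk C :=
  congrArg (Quot.mk _) (Moduli.mk_eq_mk_iff.2 h)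

theorem ModuliConj.mk_eq_mk_of_conj {B C : Realization A} (h : C.val = conj B.val) :
    ModuliConj.mk B = ModuliConj.mk C :=
  Quot.sound ⟨B, C, rfl, rfl, h⟩

instance : Nonempty (ModuliConj A) := ⟨ModuliConj.mk ⟨A, fun _ _ => rfl⟩⟩

end ModuliConj

section HasCode

variable {A : Lines 10} {e : Label ≃ Fin 10} {c : Code}

theorem exists_moduliConj_mk_eq (hA : Base (A ∘ e)) (hc : HasCode (A ∘ e) c)
    (m : ModuliConj A) : ∃ (q : Param) (hq : q.Good) (hqc : q.Realizes c),
      ModuliConj.mk ⟨q.lines ∘ e.symm, hA.sameLattice_lines hc hq hqc⟩ = m := by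
  obtain ⟨B, rfl⟩ := ModuliConj.surjective_mk m
  obtain ⟨q, hq, hqc, hB⟩ := B.2.exists_param hA hc
  exact ⟨q, hq, hqc, ModuliConj.mk_eq_mk_of_proj hB⟩

theorem irreducibleSpace_of_eq_or_eq_conj (hA : Base (A ∘ e)) (hc : HasCode (A ∘ e) c)
    (h : ∀ q q' : Param, q.Good → q'.Good → q.Realizes c → q'.Realizes c →
      q' = q ∨ q' = q.conj) : IrreducibleSpace (ModuliConj A) := by
  have : Subsingleton (ModuliConj A) := by
    refine ⟨fun m m' => ?_⟩
    obtain ⟨q, hq, hqc, rfl⟩ := exists_moduliConj_mk_eq hA hc m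
    obtain ⟨q', hq', hqc', rfl⟩ := exists_moduliConj_mk_eq hA hc m'
    obtain rfl | rfl := h q q' hq hq' hqc hqc'
    · rfl
    · exact ModuliConj.mk_eq_mk_of_conj (q.conj_lines e).symm
  exact ⟨inferInstance⟩

end HasCode

theorem star_eq_neg_of_sq_eq_neg_one {u : ℂ} (h : u ^ 2 = -1) : star u = -u := by
  obtain rfl | rfl := sq_eq_sq_iff_eq_or_eq_neg.1 (h.trans Complex.I_sq.symm) <;> simp

theorem eq_or_eq_star_of_sq_eq_neg_one {u u' : ℂ} (h : u ^ 2 = -1) (h' : u' ^ 2 = -1) :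
    u' = u ∨ u' = star u := by
  rw [star_eq_neg_of_sq_eq_neg_one h]
  exact sq_eq_sq_iff_eq_or_eq_neg.1 (h'.trans h.symm)

theorem eval_smul_of_isWeightedHomogeneous {R ι κ : Type*} [CommSemiring R] [Fintype ι]
    [Finite κ] [DecidableEq ι] {F : MvPolynomial (ι × κ) R} {d : ι → ℕ}
    (hF : F.IsWeightedHomogeneous (fun p : ι × κ => (Pi.single p.1 1 : ι → ℕ)) d)
    (c : ι → R) (x : ι × κ → R) :
    MvPolynomial.eval (fun p => c p.1 * x p) F = (∏ i, c i ^ d i) * MvPolynomial.eval x F := by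
  cases nonempty_fintype κ
  rw [MvPolynomial.eval_eq', MvPolynomial.eval_eq', Finset.mul_sum]
  refine Finset.sum_congr rfl fun m hm => ?_
  have hdeg (i : ι) : ∑ j, m (i, j) = d i := by
    rw [← hF (MvPolynomial.mem_support_iff.1 hm), Finsupp.weight_apply,
      Finsupp.sum_fintype _ _ (by simp), Finset.sum_apply, Fintype.sum_prod_type]
    simp [Pi.single_apply]
  have hscale : ∏ p : ι × κ, c p.1 ^ m p = ∏ i, c i ^ d i := by
    simp only [Fintype.prod_prod_type, Finset.prod_pow_eq_pow_sum, hdeg]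
  simp only [mul_pow, Finset.prod_mul_distrib, hscale]
  ring

section Zariski

open scoped Topology

variable {n : ℕ}

theorem eval_rep_ne_zero_iff {F : MvPolynomial (Fin n × Fin 3) ℂ} {d : Fin n → ℕ}
    (hF : F.IsWeightedHomogeneous (fun p : Fin n × Fin 3 => (Pi.single p.1 1 : Fin n → ℕ)) d)
    (c : Fin n → V) (hc : ∀ i, c i ≠ 0) :
    MvPolynomial.eval (fun p => (ofCoeffs c hc p.1).rep p.2) F ≠ 0 ↔
      MvPolynomial.eval (fun p => c p.1 p.2) F ≠ 0 := by
  choose a ha using fun i => exists_smul_eq_mk_rep ℂ (c i) (hc i)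
  have hrep : (fun p : Fin n × Fin 3 => (ofCoeffs c hc p.1).rep p.2) =
      fun p => (a p.1 : ℂ) * c p.1 p.2 :=
    funext fun p => (congrFun (ha p.1) p.2).symm
  rw [hrep, eval_smul_of_isWeightedHomogeneous hF (fun i => (a i : ℂ)), mul_ne_zero_iff]
  exact and_iff_right (Finset.prod_ne_zero_iff.2 fun i _ => pow_ne_zero _ (a i).ne_zero)

theorem continuous_ofCoeffs_eval (p : Fin n → Fin 3 → Polynomial ℂ)
    (hp : ∀ s i, (fun j => (p i j).eval s) ≠ 0) :
    Continuous[inferInstance, zariski n] fun s : CofiniteTopology ℂ =>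
      ofCoeffs (fun i j => (p i j).eval (CofiniteTopology.of.symm s)) (hp _) := by
  refine continuous_generateFrom_iff.2 ?_
  rintro _ ⟨F, d, hF, rfl⟩
  let f : Polynomial ℂ := MvPolynomial.aeval (fun q : Fin n × Fin 3 => p q.1 q.2) F
  have hf (s : ℂ) : MvPolynomial.eval (fun q : Fin n × Fin 3 => (p q.1 q.2).eval s) F =
      f.eval s := by
    rw [← Polynomial.coe_aeval_eq_eval, ← AlgHom.comp_apply, MvPolynomial.comp_aeval,
      MvPolynomial.aeval_eq_eval]
  suffices hopen : IsOpen {u : CofiniteTopology ℂ | f.eval (CofiniteTopology.of.symm u) ≠ 0} by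
    convert hopen using 1
    ext u
    exact (eval_rep_ne_zero_iff hF _ (hp _)).trans (by rw [hf, Set.mem_ofPred_eq])
  refine CofiniteTopology.isOpen_iff.2 fun ⟨s, hs⟩ => ?_
  have hf0 : f ≠ 0 := fun h => hs (by rw [h, Polynomial.eval_zero])
  refine ((Polynomial.finite_setOfPred_isRoot hf0).preimage
    CofiniteTopology.of.symm.injective.injOn).subset fun u hu => ?_
  exact not_not.1 hu

theorem continuous_paramCurve (e : Label ≃ Fin 10) :
    Continuous[inferInstance, zariski 10] fun s : CofiniteTopology ℂ =>
      (paramCurve (CofiniteTopology.of.symm s)).lines ∘ e.symm := by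
  -- All coefficients are affine functions of `s`, determined by their values at `0` and `1`.
  let p (l : Label) (j : Fin 3) : Polynomial ℂ := Polynomial.C ((paramCurve 0).coef l j) +
    Polynomial.C ((paramCurve 1).coef l j - (paramCurve 0).coef l j) * Polynomial.X
  have hp (s : ℂ) (l : Label) : (fun j => (p l j).eval s) = (paramCurve s).coef l := by
    ext j
    rcases l with k | k | _ | k
    · fin_cases k <;> fin_cases j <;> simp [p, paramCurve, Param.coef, Param.a]
    · fin_cases k <;> fin_cases j <;> simp [p, paramCurve, Param.coef, Param.b]
    · fin_cases j <;> simp [p, Param.coef]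
    · fin_cases k <;> fin_cases j <;>
        simp [p, paramCurve, Param.coef, Param.slope, Param.icept]
  have hp0 (s : ℂ) (i : Fin 10) : (fun j => (p (e.symm i) j).eval s) ≠ 0 := by
    rw [hp]
    exact Param.coef_ne_zero _ _
  convert continuous_ofCoeffs_eval (fun i => p (e.symm i)) hp0 using 2 with s
  funext i
  exact mk_eq_of_smul 1 fun j => (one_mul _).trans (congrFun (hp _ _) j)

end Zariski

theorem isIrreducible_curveParams : IsIrreducible (CofiniteTopology.of.symm ⁻¹' curveParams) := by
  refine ⟨⟨CofiniteTopology.of 3, ?_⟩,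
    (PreirreducibleSpace.isPreirreducible_univ).open_subset ?_ (Set.subset_univ _)⟩
  · simp only [Set.mem_preimage, Equiv.symm_apply_apply, curveParams]
    norm_num
  · refine CofiniteTopology.isOpen_iff.2 fun _ => ?_
    rw [← Set.preimage_compl, curveParams, compl_compl]
    exact (Set.toFinite _).preimage CofiniteTopology.of.symm.injective.injOn

theorem irreducibleSpace_of_codeCurve {A : Lines 10} {e : Label ≃ Fin 10} (hA : Base (A ∘ e))
    (hc : HasCode (A ∘ e) codeCurve) : IrreducibleSpace (ModuliConj A) := by
  let X : Set (CofiniteTopology ℂ) := CofiniteTopology.of.symm ⁻¹' curveParams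
  let realization (s : X) : Realization A :=
    ⟨_, hA.sameLattice_lines hc (Param.good_paramCurve s.2) (Param.realizes_paramCurve s.2)⟩
  have hcont : Continuous realization := by
    let _ := zariski 10
    exact continuous_induced_rng.2 ((continuous_paramCurve e).comp continuous_subtype_val)
  have hsurj : Function.Surjective (ModuliConj.mk ∘ realization) := by
    intro m
    obtain ⟨q, hq, hqc, rfl⟩ := exists_moduliConj_mk_eq hA hc m
    obtain ⟨s, hs, rfl⟩ := hqc.eq_paramCurve hq
    exact ⟨⟨CofiniteTopology.of s, hs⟩, rfl⟩
  have : IrreducibleSpace X := Subtype.irreducibleSpace isIrreducible_curveParams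
  exact hsurj.irreducibleSpace (ModuliConj.continuous_mk.comp hcont)

/-! ### The classification -/

section Classification

variable {A : Lines 10} {e : Label ≃ Fin 10}

theorem IsSolution.exists_latticeIso {ι : Type} [Star ι] {fam : ι → Lines 10} {par : Set ι}
    {f : Label ≃ Fin 10} {c : Code} {p : ι → Param} (h : IsSolution fam par f c p)
    (hA : Base (A ∘ e)) (hc : HasCode (A ∘ e) c) : ∃ t ∈ par, LatticeIso A (fam t) := by
  obtain ⟨q, hq, hqc, -⟩ := SameLattice.exists_param (fun _ _ => rfl) hA hc
  obtain ⟨t, ht, rfl⟩ := h.solve q hq hqc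
  refine ⟨t, ht, e.symm.trans f, fun S hS => ?_⟩
  have hfam : fam t ∘ e.symm.trans f = (p t).lines ∘ e.symm := by
    rw [Equiv.coe_trans, ← Function.comp_assoc, h.fam_comp_eq]
  rw [← interDim_comp, hfam]
  exact hA.sameLattice_lines hc hq hqc S hS

theorem irreducibleSpace_of_codePoint (hA : Base (A ∘ e)) (hc : HasCode (A ∘ e) codePoint) :
    IrreducibleSpace (ModuliConj A) :=
  irreducibleSpace_of_eq_or_eq_conj hA hc fun _ _ _ _ h h' =>
    Or.inl (h'.eq_paramPoint.trans h.eq_paramPoint.symm)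

theorem irreducibleSpace_of_codePair₁ (hA : Base (A ∘ e)) (hc : HasCode (A ∘ e) codePair₁) :
    IrreducibleSpace (ModuliConj A) := by
  refine irreducibleSpace_of_eq_or_eq_conj hA hc fun q q' _ _ h h' => ?_
  obtain ⟨u, hu, rfl⟩ := h.eq_paramPair₁
  obtain ⟨u', hu', rfl⟩ := h'.eq_paramPair₁
  refine (eq_or_eq_star_of_sq_eq_neg_one hu hu').imp (congrArg _) ?_
  rintro rfl
  simp [paramPair₁, Param.conj]

theorem irreducibleSpace_of_codePair₂ (hA : Base (A ∘ e)) (hc : HasCode (A ∘ e) codePair₂) :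
    IrreducibleSpace (ModuliConj A) := by
  refine irreducibleSpace_of_eq_or_eq_conj hA hc fun q q' hq hq' h h' => ?_
  obtain ⟨u, hu, rfl⟩ := h.eq_paramPair₂ hq
  obtain ⟨u', hu', rfl⟩ := h'.eq_paramPair₂ hq'
  refine (eq_or_eq_star_of_sq_eq_neg_one hu hu').imp (congrArg _) ?_
  rintro rfl
  simp [paramPair₂, Param.conj]

theorem irreducibleSpace_or_latticeIso (hA : Base (A ∘ e)) {c : Code} (hmem : c ∈ Code.all)
    (hc : HasCode (A ∘ e) c) :
    IrreducibleSpace (ModuliConj A) ∨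
      (∃ t ∈ par₁, LatticeIso A (fam₁ t)) ∨ (∃ t ∈ par₂, LatticeIso A (fam₂ t)) ∨
      (∃ t ∈ par₃, LatticeIso A (fam₃ t)) ∨ (∃ s ∈ par₄, LatticeIso A (fam₄ s)) := by
  obtain ⟨q, hq, hqc, -⟩ := SameLattice.exists_param (fun _ _ => rfl) hA hc
  simp only [Code.all, List.mem_cons, List.not_mem_nil, or_false] at hmem
  rcases hmem with rfl | rfl | rfl | rfl | rfl | rfl | rfl | rfl | rfl | rfl | rfl | rfl | rfl | rfl
  · exact .inr (.inl (isSolution₁.exists_latticeIso hA hc))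
  · exact .inr (.inr (.inl (isSolution₂.exists_latticeIso hA hc)))
  · exact .inr (.inr (.inr (.inl (isSolution₃.exists_latticeIso hA hc))))
  · exact .inr (.inr (.inr (.inr (isSolution₄.exists_latticeIso hA hc))))
  · exact .inl (irreducibleSpace_of_codeCurve hA hc)
  · exact .inl (irreducibleSpace_of_codePoint hA hc)
  · exact .inl (irreducibleSpace_of_codePair₁ hA hc)
  · exact .inl (irreducibleSpace_of_codePair₂ hA hc)
  · exact absurd hqc hq.not_realizes_codeEmpty₁
  · exact absurd hqc hq.not_realizes_codeEmpty₂
  · exact absurd hqc Param.not_realizes_codeEmpty₃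
  · exact absurd hqc Param.not_realizes_codeEmpty₄
  · exact absurd hqc Param.not_realizes_codeEmpty₅
  · exact absurd hqc Param.not_realizes_codeEmpty₆

end Classification

end LineArrangement

end

theorem mainTheorem1 :
    (∀ A : Lines 10, Function.Injective A → NonReductive A →
      numPoints A 4 = 2 → (∀ r : ℕ, 5 ≤ r → numPoints A r = 0) →
      (∃ i, ∀ P, mult A P = 4 → OnLine P (A i)) →
      IrreducibleSpace (ModuliConj A) ∨
        (∃ t ∈ par₁, LatticeIso A (fam₁ t)) ∨
        (∃ t ∈ par₂, LatticeIso A (fam₂ t)) ∨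
        (∃ t ∈ par₃, LatticeIso A (fam₃ t)) ∨
        (∃ s ∈ par₄, LatticeIso A (fam₄ s))) ∧
    HasModuli fam₁ par₁ 2 2 2 ∧
    HasModuli fam₂ par₂ 3 1 2 ∧
    HasModuli fam₃ par₃ 2 2 2 ∧
    HasModuli fam₄ par₄ 2 2 2 := by
  refine ⟨fun A hA hNR h4 h5 hline => ?_, hasModuli₁, hasModuli₂, hasModuli₃, hasModuli₄⟩
  obtain ⟨e, he⟩ := exists_equiv_frame hA hNR h4 h5 hline
  obtain ⟨σ, hσ, c, hmem, hc⟩ := he.exists_comp_hasCode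
  exact irreducibleSpace_or_latticeIso (e := σ.trans e) hσ.toBase hmem hc
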